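/- For positive integers $n,m$ let $T_{n,m}=\mathbb Z/n\mathbb Z\times\mathbb Z/m\mathbb Z$, viewed as a directed graph in which each vertex $(x,y)$ has two outgoing edges, one to $(x+1,y)$ and one to $(x,y+1)$. A cycle-rooted spanning forest (CRSF) of $T_{n,m}$ is obtained by choosing exactly one of the two outgoing edges at every vertex; its cycles are the directed cycles formed by the chosen edges, that is, the periodic orbits of the map sending each vertex to the endpoint of its chosen edge. Let $\mathbb P$ be the uniform probability measure on the $2^{nm}$ CRSFs of $T_{n,m}$ (equivalently, the edges are chosen independently with probability $1/2$ each). Let $C\in\mathbb R$ with $|C|>\sqrt2$, and let $m=m(n)$ be positive integers with $m=n+C\sqrt{n\log n}\,(1+o(1))$ as $n\to\infty$. Then for each $\epsilon>0$ there is $n_0$ such that for all $n\ge n_0$, in the CRSF on $T_{n,m}$, $$\mathbb P\big(\text{there exist at least two disjoint cycles}\big)\le n^{\frac12-\frac{C^2}{4}+\epsilon}.$$ -/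

import Mathlib

open Filter Topology MeasureTheory ProbabilityTheory

namespace CRSF

/-- The `n, m`-torus `ℤ² / ⟨(n, 0), (0, m)⟩`. -/
abbrev Torus (n m : ℕ) : Type := ZMod n × ZMod m

/-- A cycle-rooted spanning forest on the torus: each vertex `v` has exactly one outgoing edge,
which is the edge to the east if `σ v = true` and the edge to the north if `σ v = false`. -/
abbrev Forest (n m : ℕ) : Type := Torus n m → Bool

/-- The dynamical system `φ` of a forest: `φ (x, y)` is the vertex that the outgoing edge of
`(x, y)` points to, either `(x + 1, y)` or `(x, y + 1)`. -/
def next {n m : ℕ} (σ : Forest n m) (v : Torus n m) : Torus n m :=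
  if σ v = true then (v.1 + 1, v.2) else (v.1, v.2 + 1)

/-- `c` is the vertex set of a directed cycle of the forest, that is, the orbit under `φ` of some
periodic point. -/
def IsCycle {n m : ℕ} (σ : Forest n m) (c : Set (Torus n m)) : Prop :=
  ∃ v ∈ Function.periodicPts (next σ), c = Set.range fun k : ℕ => (next σ)^[k] v

/-- The uniform probability measure on cycle-rooted spanning forests (for `n, m ≥ 1`). -/
noncomputable def crsfMeasure (n m : ℕ) : Measure (Forest n m) := uniformOn Set.univ

/-- The event that there are at least two disjoint cycles. -/
def twoDisjointCycles (n m : ℕ) : Set (Forest n m) :=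
  {σ | ∃ c₁ c₂ : Set (Torus n m), IsCycle σ c₁ ∧ IsCycle σ c₂ ∧ Disjoint c₁ c₂}

end CRSF

namespace CRSF

/-! ### Exploring independent bits -/

/-! Until a trajectory repeats a vertex, it reads fresh independent fair bits. The same holds for
two trajectories that have not met (`crsfMeasure_real_explore_le`). Two disjoint cycles are split by
the length of the shorter one, with threshold `ℓ` about `n ^ (7/5)`; this gives three rare events,
handled by a union bound.

A shorter cycle of length below `ℓ` that winds `p` times east and `q` times north makes `n p` east
and `m q` north steps. If `p = q = k + 1`, the Gaussian bound for binomial probabilities gives about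
`n ^ (-1/2) * r ^ (k + 1)`, where `r = exp (-(m - n)² / (4 max n m))` is about `n ^ (-C² / 4)`. Such
a cycle meets the column `x = 0`, so only `m` starting points count, and summing over `k` gives
order `√n * r`, the main term. If `p ≠ q`, the east and north counts differ by at least `n / 2`,
which is stretched-exponentially unlikely.

If both cycles have length at least `ℓ`, take a vertex of the shorter cycle whose successor on the
antidiagonal, among the vertices of the two cycles, lies on the other cycle. The dynamics is
injective on the union and steps from antidiagonal to antidiagonal, so this adjacency persists. The
segments between adjacent vertices are disjoint, so the gaps over one period sum to at most `n m`
(`sum_gap_le`). The gap is thus a lazy random walk that stays positive with small average, which a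
potential function shows to be unlikely (`card_gap_le`). -/

theorem iterate_next_congr {n m : ℕ} {σ σ' : Forest n m} {v : Torus n m} {t : ℕ}
    (h : ∀ i < t, σ ((next σ)^[i] v) = σ' ((next σ')^[i] v)) :
    (next σ)^[t] v = (next σ')^[t] v := by
  induction t with
  | zero => rfl
  | succ t ih =>
    have h1 := ih fun i hi => h i (by omega)
    have h2 := h t (by omega)
    rw [Function.iterate_succ_apply', Function.iterate_succ_apply', next, next, h2, h1]

/-- The first `L` bits read along the trajectory of `v`. -/
def bits {n m : ℕ} (σ : Forest n m) (v : Torus n m) (L : ℕ) : Fin L → Bool :=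
  fun i => σ ((next σ)^[i] v)

section Exploration

variable {n m : ℕ} [NeZero n] [NeZero m]

theorem isProbabilityMeasure_crsfMeasure (n m : ℕ) [NeZero n] [NeZero m] :
    IsProbabilityMeasure (crsfMeasure n m) :=
  isProbabilityMeasure_uniformOn Set.finite_univ Set.univ_nonempty

attribute [instance] isProbabilityMeasure_crsfMeasure

open Classical in
theorem crsfMeasure_real_eq (A : Set (Forest n m)) :
    (crsfMeasure n m).real A =
      ((Finset.univ.filter fun σ => σ ∈ A).card : ℝ) / 2 ^ Fintype.card (Torus n m) := by
  have hA : A = ((Finset.univ.filter fun σ => σ ∈ A : Finset (Forest n m)) : Set (Forest n m)) := by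
    ext; simp
  rw [Measure.real, crsfMeasure, uniformOn_univ, ENNReal.toReal_div]
  conv_lhs => rw [hA]
  rw [Measure.count_apply_finset]
  simp

open Classical in
theorem card_cylinder {α ι : Type*} [Fintype α] [Fintype ι] (u : ι → α)
    (hu : Function.Injective u) (s : ι → Bool) :
    (Finset.univ.filter fun σ : α → Bool => ∀ i, σ (u i) = s i).card * 2 ^ Fintype.card ι =
      2 ^ Fintype.card α := by
  -- Overwriting the bits at the sites `u i` is a bijection between any two cylinders, so all of
  -- them have equal size and together they partition the configurations.
  have key : ∀ b : ι → Bool,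
      (Finset.univ.filter fun σ : α → Bool => ∀ i, σ (u i) = b i).card =
        (Finset.univ.filter fun σ : α → Bool => ∀ i, σ (u i) = s i).card := by
    intro b
    refine Finset.card_bij'
      (fun σ _ => fun a => if h : ∃ i, u i = a then s h.choose else σ a)
      (fun σ _ => fun a => if h : ∃ i, u i = a then b h.choose else σ a) ?_ ?_ ?_ ?_
    · intro σ _
      simp only [Finset.mem_filter, Finset.mem_univ, true_and]
      intro i
      have h : ∃ j, u j = u i := ⟨i, rfl⟩
      rw [dif_pos h, hu h.choose_spec]
    · intro σ _
      simp only [Finset.mem_filter, Finset.mem_univ, true_and]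
      intro i
      have h : ∃ j, u j = u i := ⟨i, rfl⟩
      rw [dif_pos h, hu h.choose_spec]
    · intro σ hσ
      simp only [Finset.mem_filter, Finset.mem_univ, true_and] at hσ
      funext a
      by_cases h : ∃ i, u i = a
      · simp only [dif_pos h]
        rw [← hσ, h.choose_spec]
      · simp only [dif_neg h]
    · intro σ hσ
      simp only [Finset.mem_filter, Finset.mem_univ, true_and] at hσ
      funext a
      by_cases h : ∃ i, u i = a
      · simp only [dif_pos h]
        rw [← hσ, h.choose_spec]
      · simp only [dif_neg h]
  have h := Finset.card_eq_sum_card_fiberwise (s := (Finset.univ : Finset (α → Bool)))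
    (t := (Finset.univ : Finset (ι → Bool))) (f := fun σ i => σ (u i)) (fun _ _ => by simp)
  have h2 : ∀ b : ι → Bool, (Finset.univ.filter fun σ : α → Bool => (fun i => σ (u i)) = b).card =
      (Finset.univ.filter fun σ : α → Bool => ∀ i, σ (u i) = s i).card := by
    intro b
    rw [← key b]
    congr 1
    ext σ
    simp [funext_iff]
  rw [Finset.sum_congr rfl fun b _ => h2 b] at h
  simp only [Finset.card_univ, Fintype.card_fun, Fintype.card_bool, Finset.sum_const,
    smul_eq_mul] at h
  rw [h, mul_comm]

/-- By `hX` the bits read determine the sites visited. Hence all forests in the event read at the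
same distinct sites, and the event lies in a single cylinder. -/
theorem crsfMeasure_real_explore_eq_le {ι : Type*} [Fintype ι] (X : Forest n m → ι → Torus n m)
    (hX : ∀ σ σ' : Forest n m, (∀ i, σ (X σ i) = σ' (X σ' i)) → X σ = X σ') (s : ι → Bool) :
    (crsfMeasure n m).real {σ | Function.Injective (X σ) ∧ (fun i => σ (X σ i)) = s} ≤
      1 / 2 ^ Fintype.card ι := by
  classical
  by_cases hne : ∃ τ : Forest n m, Function.Injective (X τ) ∧ (fun i => τ (X τ i)) = s
  · obtain ⟨τ, hτ, hs⟩ := hne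
    rw [crsfMeasure_real_eq, div_le_div_iff₀ (by positivity) (by positivity), one_mul,
      ← Nat.cast_ofNat (R := ℝ) (n := 2)]
    norm_cast
    rw [← card_cylinder (X τ) hτ s]
    refine Nat.mul_le_mul_right _ (Finset.card_le_card ?_)
    intro σ hσ
    simp only [Finset.mem_filter, Finset.mem_univ, true_and, Set.mem_ofPred_eq] at hσ ⊢
    have : X σ = X τ := hX σ τ fun i => by
      rw [congrFun hσ.2 i, ← hs]
    intro i
    rw [← this]
    exact congrFun hσ.2 i
  · have : {σ : Forest n m | Function.Injective (X σ) ∧ (fun i => σ (X σ i)) = s} = ∅ :=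
      Set.eq_empty_of_forall_notMem fun σ hσ => hne ⟨σ, hσ⟩
    rw [this, measureReal_empty]
    positivity

/-- If the sites `X σ` are explored adaptively, then as long as they are distinct the bits read
there are independent. -/
theorem crsfMeasure_real_explore_le {ι : Type*} [Fintype ι] (X : Forest n m → ι → Torus n m)
    (hX : ∀ σ σ' : Forest n m, (∀ i, σ (X σ i) = σ' (X σ' i)) → X σ = X σ')
    (S : Finset (ι → Bool)) :
    (crsfMeasure n m).real {σ | Function.Injective (X σ) ∧ (fun i => σ (X σ i)) ∈ S} ≤
      S.card / 2 ^ Fintype.card ι := by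
  calc _ ≤ (crsfMeasure n m).real (⋃ s ∈ S,
        {σ | Function.Injective (X σ) ∧ (fun i => σ (X σ i)) = s}) := by
        refine measureReal_mono ?_ (measure_ne_top _ _)
        rintro σ ⟨h1, h2⟩
        simp only [Set.mem_iUnion]
        exact ⟨_, h2, h1, rfl⟩
    _ ≤ ∑ s ∈ S, (crsfMeasure n m).real
        {σ | Function.Injective (X σ) ∧ (fun i => σ (X σ i)) = s} :=
        measureReal_biUnion_finset_le _ _
    _ ≤ ∑ s ∈ S, 1 / 2 ^ Fintype.card ι :=
        Finset.sum_le_sum fun s _ => crsfMeasure_real_explore_eq_le X hX s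
    _ = _ := by rw [Finset.sum_const, nsmul_eq_mul]; ring

theorem crsfMeasure_real_single_le (v : Torus n m) (L : ℕ) (S : Finset (Fin L → Bool)) :
    (crsfMeasure n m).real {σ | Function.Injective (fun i : Fin L => (next σ)^[i] v) ∧
      bits σ v L ∈ S} ≤ S.card / 2 ^ L := by
  have := crsfMeasure_real_explore_le (n := n) (m := m)
    (fun σ (i : Fin L) => (next σ)^[i] v) (fun σ σ' h => by
      funext i
      exact iterate_next_congr fun j hj => h ⟨j, by omega⟩) S
  rw [Fintype.card_fin] at this
  exact this

/-- Two injective trajectories that never meet visit `2 L` distinct sites, so their bits are bounded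
as if independent. Meetings at different times are excluded too. -/
theorem crsfMeasure_real_pair_le (v w : Torus n m) (L : ℕ)
    (S : Finset ((Fin L → Bool) × (Fin L → Bool))) :
    (crsfMeasure n m).real {σ | Function.Injective (fun i : Fin L => (next σ)^[i] v) ∧
      Function.Injective (fun i : Fin L => (next σ)^[i] w) ∧
      (∀ i j : Fin L, (next σ)^[i] v ≠ (next σ)^[j] w) ∧
      (bits σ v L, bits σ w L) ∈ S} ≤ S.card / 4 ^ L := by
  have := crsfMeasure_real_explore_le (n := n) (m := m)
    (fun σ => Sum.elim (fun i : Fin L => (next σ)^[i] v) (fun i : Fin L => (next σ)^[i] w))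
    (fun σ σ' h => by
      funext i
      rcases i with i | i
      · exact iterate_next_congr fun j hj => h (Sum.inl ⟨j, by omega⟩)
      · exact iterate_next_congr fun j hj => h (Sum.inr ⟨j, by omega⟩))
    (S.map (Equiv.sumArrowEquivProdArrow (Fin L) (Fin L) Bool).symm.toEmbedding)
  rw [Finset.card_map, Fintype.card_sum, Fintype.card_fin, pow_add, ← mul_pow,
    show (2 : ℝ) * 2 = 4 by norm_num] at this
  refine le_trans (measureReal_mono ?_ (measure_ne_top _ _)) this
  rintro σ ⟨h1, h2, h3, h4⟩
  refine ⟨?_, Finset.mem_map.mpr ⟨_, h4, ?_⟩⟩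
  · rintro (i | i) (j | j) hij
    · exact congrArg Sum.inl (h1 hij)
    · exact absurd hij (h3 i j)
    · exact absurd hij.symm (h3 j i)
    · exact congrArg Sum.inr (h2 hij)
  · funext i
    rcases i with i | i <;> rfl

end Exploration

/-! ### Binomial probabilities -/

theorem sq_choose_two_mul_le (a : ℕ) :
    ((Nat.choose (a + a) a : ℝ) / 2 ^ (a + a)) ^ 2 * (2 * a + 1) ≤ 1 := by
  induction a with
  | zero => simp
  | succ a ih =>
    have h : ((a : ℝ) + 1) * Nat.choose (a + 1 + (a + 1)) (a + 1) =
        2 * (2 * a + 1) * Nat.choose (a + a) a := by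
      have := Nat.succ_mul_centralBinom_succ a
      rw [Nat.centralBinom, Nat.centralBinom] at this
      rw [← two_mul, ← two_mul]
      exact_mod_cast this
    set x := (Nat.choose (a + a) a : ℝ) / 2 ^ (a + a) with hx
    have h' : (Nat.choose (a + 1 + (a + 1)) (a + 1) : ℝ) / 2 ^ (a + 1 + (a + 1)) =
        (2 * a + 1) / (2 * (a + 1)) * x := by
      rw [hx, show a + 1 + (a + 1) = a + a + 2 by ring, pow_add]
      rw [show a + 1 + (a + 1) = a + a + 2 by ring] at h
      field_simp
      linear_combination h
    rw [h']
    push_cast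
    refine le_trans ?_ ih
    have e : ((2 * a + 1) / (2 * (a + 1)) * x) ^ 2 * (2 * ((a : ℝ) + 1) + 1) =
        x ^ 2 * ((2 * a + 1) ^ 2 * (2 * a + 3) / (4 * (a + 1) ^ 2)) := by
      field_simp
      ring
    rw [e]
    refine mul_le_mul_of_nonneg_left ?_ (sq_nonneg _)
    rw [div_le_iff₀ (by positivity)]
    have : (0 : ℝ) ≤ a := Nat.cast_nonneg a
    nlinarith

theorem choose_two_mul_le (a : ℕ) :
    (Nat.choose (a + a) a : ℝ) / 2 ^ (a + a) ≤ 1 / Real.sqrt (2 * a + 1) := by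
  have h := sq_choose_two_mul_le a
  rw [le_div_iff₀ (by positivity)]
  refine le_of_sq_le_sq ?_ (by norm_num)
  rw [mul_pow, Real.sq_sqrt (by positivity)]
  simpa using h

/-- Starting from the central coefficient, each increment of `d` multiplies the probability by `1 -
(d + 1) / (2 (a + d + 1))`, at most `exp (-(d + 1) / (2 B))`. The bound `B` is kept fixed so that
the exponents add up. -/
theorem choose_add_le_of_le (a B d : ℕ) (hB : a + d ≤ B) :
    (Nat.choose (a + (a + d)) a : ℝ) / 2 ^ (a + (a + d)) ≤
      1 / Real.sqrt (2 * a + 1) * Real.exp (-((d : ℝ) ^ 2 / (4 * B))) := by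
  rcases Nat.eq_zero_or_pos B with rfl | hB0
  · obtain ⟨rfl, rfl⟩ : a = 0 ∧ d = 0 := by omega
    simp
  have hB0' : (0 : ℝ) < B := by exact_mod_cast hB0
  -- The exponents sum exactly to `d (d + 1) / (4 B)`; this is weakened to `d²` only at the end.
  have key : ∀ d : ℕ, a + d ≤ B → (Nat.choose (a + (a + d)) a : ℝ) / 2 ^ (a + (a + d)) ≤
      1 / Real.sqrt (2 * a + 1) * Real.exp (-((d : ℝ) * (d + 1) / (4 * B))) := by
    intro d
    induction d with
    | zero => intro _; simpa using choose_two_mul_le a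
    | succ d ih =>
      intro hd
      have ih' := ih (by omega)
      have hr : (Nat.choose (a + (a + (d + 1))) a : ℝ) * (a + d + 1) =
          Nat.choose (a + (a + d)) a * (a + a + d + 1) := by
        have h1 := Nat.choose_mul_succ_eq (a + (a + d)) a
        have h2 : a + (a + d) + 1 - a = a + d + 1 := by omega
        rw [h2] at h1
        have : ((Nat.choose (a + (a + d)) a * (a + (a + d) + 1) : ℕ) : ℝ) =
          ((Nat.choose (a + (a + d) + 1) a * (a + d + 1) : ℕ) : ℝ) := by rw [h1]
        push_cast at this
        rw [show a + (a + (d + 1)) = a + (a + d) + 1 by ring]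
        linarith
      have hpos : (0 : ℝ) < (a : ℝ) + d + 1 := by positivity
      have hr' : (Nat.choose (a + (a + (d + 1))) a : ℝ) / 2 ^ (a + (a + (d + 1))) =
          Nat.choose (a + (a + d)) a / 2 ^ (a + (a + d)) * (1 - (d + 1) / (2 * (a + d + 1))) := by
        rw [show a + (a + (d + 1)) = a + (a + d) + 1 by ring] at hr ⊢
        rw [pow_succ]
        field_simp
        linear_combination hr
      have hle : (1 : ℝ) - (d + 1) / (2 * (a + d + 1)) ≤ Real.exp (-((d + 1) / (2 * B))) := by
        have h1 : (1 : ℝ) - (d + 1) / (2 * (a + d + 1)) ≤ 1 - (d + 1) / (2 * B) := by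
          have : ((d : ℝ) + 1) / (2 * B) ≤ (d + 1) / (2 * (a + d + 1)) := by
            have : (a : ℝ) + d + 1 ≤ B := by exact_mod_cast hd
            gcongr
          linarith
        have h2 := Real.add_one_le_exp (-(((d : ℝ) + 1) / (2 * B)))
        linarith
      rw [hr']
      calc _ ≤ (Nat.choose (a + (a + d)) a : ℝ) / 2 ^ (a + (a + d)) *
            Real.exp (-((d + 1) / (2 * B))) := by gcongr
        _ ≤ 1 / Real.sqrt (2 * a + 1) * Real.exp (-((d : ℝ) * (d + 1) / (4 * B))) *
            Real.exp (-((d + 1) / (2 * B))) := by gcongr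
        _ = _ := by
          rw [mul_assoc, ← Real.exp_add]
          congr 2
          push_cast
          field_simp
          ring
  refine (key d hB).trans ?_
  gcongr
  nlinarith [Nat.cast_nonneg (α := ℝ) d]

/-- A Gaussian bound for binomial probabilities. -/
theorem choose_div_two_pow_le (a b : ℕ) :
    (Nat.choose (a + b) a : ℝ) / 2 ^ (a + b) ≤
      1 / Real.sqrt (2 * (min a b : ℕ) + 1) *
        Real.exp (-(((a : ℝ) - b) ^ 2 / (4 * (max a b : ℕ)))) := by
  rcases le_total a b with h | h
  · obtain ⟨d, rfl⟩ := Nat.exists_eq_add_of_le h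
    rw [min_eq_left h, max_eq_right h]
    have := choose_add_le_of_le a (a + d) d le_rfl
    convert this using 4
    push_cast
    ring
  · obtain ⟨d, rfl⟩ := Nat.exists_eq_add_of_le h
    rw [min_eq_right h, max_eq_left h]
    have := choose_add_le_of_le b (b + d) d le_rfl
    rw [Nat.choose_symm_add, add_comm (b + d) b]
    convert this using 4
    push_cast
    ring

theorem choose_div_two_pow_le_exp (a b : ℕ) :
    (Nat.choose (a + b) a : ℝ) / 2 ^ (a + b) ≤
      Real.exp (-(((a : ℝ) - b) ^ 2 / (4 * (max a b : ℕ)))) := by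
  refine (choose_div_two_pow_le a b).trans (mul_le_of_le_one_left (Real.exp_pos _).le ?_)
  rw [div_le_one (by positivity), Real.one_le_sqrt]
  linarith [Nat.cast_nonneg (α := ℝ) (min a b)]

theorem card_filter_card_true (L a : ℕ) :
    (Finset.univ.filter fun s : Fin L → Bool =>
      (Finset.univ.filter fun i => s i = true).card = a).card ≤ L.choose a := by
  have := Finset.card_le_card_of_injOn
    (s := Finset.univ.filter fun s : Fin L → Bool =>
      (Finset.univ.filter fun i => s i = true).card = a)
    (t := Finset.powersetCard a (Finset.univ : Finset (Fin L)))
    (fun s => Finset.univ.filter fun i => s i = true)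
    (fun s hs => by simpa [Finset.mem_powersetCard] using hs)
    (fun s _ s' _ h => by
      funext i
      have : i ∈ Finset.univ.filter (fun i => s i = true) ↔
        i ∈ Finset.univ.filter (fun i => s' i = true) := by
        simp only at h
        rw [h]
      simp only [Finset.mem_filter, Finset.mem_univ, true_and] at this
      exact Bool.eq_iff_iff.mpr this)
  simpa using this

/-! ### Two walks that stay apart at a small average distance -/

/-- The increment of the gap between two walkers that read the bits `b` and `b'`. -/
def gapStep (b b' : Bool) : ℤ := (if b' then 1 else 0) - (if b then 1 else 0)

/-- The weight `exp (-μ ∑ gap)` of a pair of walks, started with the given gap, that stay apart. -/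
noncomputable def gapWeight (μ : ℝ) : (L : ℕ) → (Fin L → Bool) → (Fin L → Bool) → ℤ → ℝ
  | 0, _, _, g => if 1 ≤ g then 1 else 0
  | L + 1, s, s', g => if 1 ≤ g then
      Real.exp (-μ * g) * gapWeight μ L (Fin.tail s) (Fin.tail s') (g + gapStep (s 0) (s' 0)) else 0

theorem gapWeight_nonneg (μ : ℝ) (L : ℕ) (s s' : Fin L → Bool) (g : ℤ) :
    0 ≤ gapWeight μ L s s' g := by
  induction L generalizing g with
  | zero => rw [gapWeight]; split_ifs <;> norm_num
  | succ L ih =>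
    rw [gapWeight]
    split_ifs
    · exact mul_nonneg (Real.exp_pos _).le (ih _ _ _)
    · exact le_rfl

theorem gapWeight_eq_exp (μ : ℝ) (L : ℕ) (s s' : Fin L → Bool) (γ : ℕ → ℤ)
    (hγ : ∀ t : Fin L, γ (t + 1) = γ t + gapStep (s t) (s' t)) (h1 : ∀ t ≤ L, 1 ≤ γ t) :
    gapWeight μ L s s' (γ 0) = Real.exp (-μ * ∑ t ∈ Finset.range L, (γ t : ℝ)) := by
  induction L generalizing γ with
  | zero => simp [gapWeight, h1 0 le_rfl]
  | succ L ih =>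
    rw [gapWeight, if_pos (h1 0 (by omega)), Finset.sum_range_succ', mul_add, Real.exp_add,
      mul_comm]
    congr 1
    have h0 := hγ 0
    simp only [Fin.val_zero] at h0
    rw [← h0]
    refine ih (Fin.tail s) (Fin.tail s') (fun t => γ (t + 1)) ?_ fun t ht => h1 (t + 1) (by omega)
    intro t
    exact hγ t.succ

theorem sum_fin_succ_bool {L : ℕ} (f : (Fin (L + 1) → Bool) → ℝ) :
    ∑ s, f s = ∑ s : Fin L → Bool, f (Fin.cons true s) + ∑ s : Fin L → Bool, f (Fin.cons false s) := by
  rw [← Equiv.sum_comp (Fin.consEquiv fun _ => Bool) f, Fintype.sum_prod_type]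
  simp [Fin.consEquiv]

/-- The potential `ψ g = 2R² - (max (R - g) 0)²` lies between `R²` and `2R²` for `g ≥ 0`. Below `R`
its second difference is `-2`, so averaging over the steps `+1, -1, 0, 0` loses `1/2`, at least a
fraction `1 / (4R²)` of `ψ`. From `R` on, the factor `exp (-μ g)` with `μ = 1 / (4R³)` supplies the
same decay. -/
theorem gapPotential_step (R : ℕ) (hR : 1 ≤ R) (g : ℤ) (hg : 1 ≤ g) :
    Real.exp (-(1 / (4 * (R : ℝ) ^ 3)) * g) *
      ((2 * (R : ℝ) ^ 2 - (max (R - (g + 1)) 0 : ℤ) ^ 2) +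
        (2 * (R : ℝ) ^ 2 - (max (R - (g - 1)) 0 : ℤ) ^ 2) +
        2 * (2 * (R : ℝ) ^ 2 - (max (R - g) 0 : ℤ) ^ 2)) ≤
      4 * Real.exp (-(1 / (4 * (R : ℝ) ^ 2))) * (2 * (R : ℝ) ^ 2 - (max (R - g) 0 : ℤ) ^ 2) := by
  have hR0 : (0 : ℝ) < R := by exact_mod_cast hR
  have hg0 : (1 : ℝ) ≤ g := by exact_mod_cast hg
  by_cases h : (R : ℤ) ≤ g
  · rw [max_eq_right (show (R : ℤ) - g ≤ 0 by omega),
      max_eq_right (show (R : ℤ) - (g + 1) ≤ 0 by omega)]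
    have hgR : (R : ℝ) ≤ g := by exact_mod_cast h
    have he : Real.exp (-(1 / (4 * (R : ℝ) ^ 3)) * g) ≤ Real.exp (-(1 / (4 * (R : ℝ) ^ 2))) := by
      refine Real.exp_le_exp.mpr ?_
      rw [neg_mul, neg_le_neg_iff]
      calc 1 / (4 * (R : ℝ) ^ 2) = 1 / (4 * (R : ℝ) ^ 3) * R := by field_simp
        _ ≤ _ := by gcongr
    calc _ ≤ Real.exp (-(1 / (4 * (R : ℝ) ^ 3)) * g) * (8 * (R : ℝ) ^ 2) := by
          refine mul_le_mul_of_nonneg_left ?_ (Real.exp_pos _).le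
          push_cast
          nlinarith [sq_nonneg (max ((R : ℝ) - (g - 1)) 0)]
      _ ≤ Real.exp (-(1 / (4 * (R : ℝ) ^ 2))) * (8 * (R : ℝ) ^ 2) := by gcongr
      _ = _ := by push_cast; ring
  · rw [max_eq_left (show (0 : ℤ) ≤ (R : ℤ) - g by omega),
      max_eq_left (show (0 : ℤ) ≤ (R : ℤ) - (g + 1) by omega),
      max_eq_left (show (0 : ℤ) ≤ (R : ℤ) - (g - 1) by omega)]
    have hgR : (g : ℝ) < R := by exact_mod_cast not_le.mp h
    push_cast
    have h1 : Real.exp (-(1 / (4 * (R : ℝ) ^ 3)) * g) ≤ 1 := by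
      rw [Real.exp_le_one_iff]
      have : 0 < 1 / (4 * (R : ℝ) ^ 3) := by positivity
      nlinarith
    have h2 := Real.add_one_le_exp (-(1 / (4 * (R : ℝ) ^ 2)))
    have h3 : 1 / (4 * (R : ℝ) ^ 2) * (2 * (R : ℝ) ^ 2 - (R - g) ^ 2) ≤ 1 / 2 := by
      rw [div_mul_eq_mul_div, one_mul, div_le_div_iff₀ (by positivity) (by positivity)]
      nlinarith [sq_nonneg ((R : ℝ) - g)]
    have hψ : 0 ≤ 2 * (R : ℝ) ^ 2 - (R - g) ^ 2 := by nlinarith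
    calc _ ≤ 1 * ((2 * (R : ℝ) ^ 2 - (R - (g + 1)) ^ 2) + (2 * (R : ℝ) ^ 2 - (R - (g - 1)) ^ 2) +
        2 * (2 * (R : ℝ) ^ 2 - (R - g) ^ 2)) := by
          refine mul_le_mul_of_nonneg_right h1 ?_
          nlinarith
      _ ≤ 4 * ((-(1 / (4 * (R : ℝ) ^ 2)) + 1) * (2 * (R : ℝ) ^ 2 - (R - g) ^ 2)) := by nlinarith
      _ ≤ _ := by
          rw [mul_assoc]
          gcongr

/-- Iterating `gapPotential_step` along the walk, with `ψ / R² ≥ 1` dominating the final indicator.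
Gap `0` is admitted because a step from gap `1` can reach it; the weight vanishes there. -/
theorem sum_gapWeight_le (R : ℕ) (hR : 1 ≤ R) (L : ℕ) (g : ℤ) (hg : 0 ≤ g) :
    ∑ s, ∑ s', gapWeight (1 / (4 * (R : ℝ) ^ 3)) L s s' g ≤
      4 ^ L * Real.exp (-(L / (4 * (R : ℝ) ^ 2))) *
        ((2 * (R : ℝ) ^ 2 - (max (R - g) 0 : ℤ) ^ 2) / (R : ℝ) ^ 2) := by
  have hR0 : (0 : ℝ) < R := by exact_mod_cast hR
  induction L generalizing g with
  | zero =>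
    rw [Fintype.sum_unique, Fintype.sum_unique, gapWeight]
    simp only [pow_zero, Nat.cast_zero, zero_div, neg_zero, Real.exp_zero, one_mul]
    rw [le_div_iff₀ (by positivity)]
    have h1 : (0 : ℤ) ≤ max (R - g) 0 := le_max_right _ _
    have h2 : max ((R : ℤ) - g) 0 ≤ R := max_le (by omega) (by omega)
    have h3 : ((max ((R : ℤ) - g) 0 : ℤ) : ℝ) ^ 2 ≤ (R : ℝ) ^ 2 := by
      have : (max ((R : ℤ) - g) 0) ^ 2 ≤ (R : ℤ) ^ 2 := by gcongr
      exact_mod_cast this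
    split_ifs <;> nlinarith
  | succ L ih =>
    have hψ : 0 ≤ (2 * (R : ℝ) ^ 2 - (max (R - g) 0 : ℤ) ^ 2) / (R : ℝ) ^ 2 := by
      have h2 : max ((R : ℤ) - g) 0 ≤ R := max_le (by omega) (by omega)
      have h3 : ((max ((R : ℤ) - g) 0 : ℤ) : ℝ) ^ 2 ≤ (R : ℝ) ^ 2 := by
        have : (max ((R : ℤ) - g) 0) ^ 2 ≤ (R : ℤ) ^ 2 := by gcongr
        exact_mod_cast this
      exact div_nonneg (by nlinarith) (by positivity)
    by_cases hg1 : 1 ≤ g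
    · have hrec : ∀ b b', ∑ s : Fin L → Bool, ∑ s' : Fin L → Bool,
          gapWeight (1 / (4 * (R : ℝ) ^ 3)) (L + 1) (Fin.cons b s) (Fin.cons b' s') g =
          Real.exp (-(1 / (4 * (R : ℝ) ^ 3)) * g) * ∑ s : Fin L → Bool, ∑ s' : Fin L → Bool,
            gapWeight (1 / (4 * (R : ℝ) ^ 3)) L s s' (g + gapStep b b') := by
        intro b b'
        simp only [gapWeight, if_pos hg1, Fin.tail_cons, Fin.cons_zero, Finset.mul_sum]
      rw [sum_fin_succ_bool]
      simp only [sum_fin_succ_bool (fun s' => gapWeight _ _ _ s' _), Finset.sum_add_distrib, hrec]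
      have h00 := ih (g + gapStep false false) (by simp [gapStep]; omega)
      have h01 := ih (g + gapStep false true) (by simp [gapStep]; omega)
      have h10 := ih (g + gapStep true false) (by simp [gapStep]; omega)
      have h11 := ih (g + gapStep true true) (by simp [gapStep]; omega)
      rw [← mul_add, ← mul_add, ← mul_add]
      have hstep := gapPotential_step R hR g hg1
      set E := Real.exp (-(1 / (4 * (R : ℝ) ^ 3)) * g) with hE
      have hE0 : 0 < E := Real.exp_pos _
      refine (mul_le_mul_of_nonneg_left (add_le_add (add_le_add h11 h10) (add_le_add h01 h00))
        hE0.le).trans ?_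
      have e : Real.exp (-(((L + 1 : ℕ) : ℝ) / (4 * (R : ℝ) ^ 2))) =
          Real.exp (-(L / (4 * (R : ℝ) ^ 2))) * Real.exp (-(1 / (4 * (R : ℝ) ^ 2))) := by
        rw [← Real.exp_add]
        congr 1
        push_cast
        ring
      rw [e, pow_succ]
      simp only [gapStep, if_true, Bool.false_eq_true, if_false, sub_self, add_zero, sub_zero,
        zero_sub]
      rw [← sub_eq_add_neg]
      set K := (4 : ℝ) ^ L * Real.exp (-(L / (4 * (R : ℝ) ^ 2))) with hK
      have hK0 : 0 < K := by positivity
      have := mul_le_mul_of_nonneg_left hstep (div_pos hK0 (show (0 : ℝ) < (R : ℝ) ^ 2 by positivity)).le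
      calc _ = _ := ?_
        _ ≤ _ := this
        _ = _ := ?_
      · rw [hK]; ring
      · rw [hK]; ring
    · simp only [gapWeight, if_neg hg1, Finset.sum_const_zero]
      exact mul_nonneg (by positivity) hψ

/-- Markov's inequality: each pair in `S` has weight at least `exp (-μ A)`. Since `2 A ≤ L R`,
undoing this factor costs at most `exp (L / (8R²))`, half of the decay exponent `L / (4R²)`. -/
theorem card_gap_le (R : ℕ) (hR : 1 ≤ R) (L A : ℕ) (hA : 2 * A ≤ L * R) (g : ℤ) (hg : 0 ≤ g)
    (S : Finset ((Fin L → Bool) × (Fin L → Bool)))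
    (hS : ∀ p ∈ S, ∃ γ : ℕ → ℤ, γ 0 = g ∧ (∀ t : Fin L, γ (t + 1) = γ t + gapStep (p.1 t) (p.2 t)) ∧
      (∀ t ≤ L, 1 ≤ γ t) ∧ ∑ t ∈ Finset.range L, γ t ≤ A) :
    (S.card : ℝ) / 4 ^ L ≤ 2 * Real.exp (-(L / (8 * (R : ℝ) ^ 2))) := by
  have hR0 : (0 : ℝ) < R := by exact_mod_cast hR
  set μ : ℝ := 1 / (4 * (R : ℝ) ^ 3) with hμ
  have hμ0 : 0 < μ := by positivity
  have h1 : (S.card : ℝ) * Real.exp (-μ * A) ≤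
      ∑ s, ∑ s', gapWeight μ L s s' g := by
    rw [← Fintype.sum_prod_type', ← nsmul_eq_mul, ← Finset.sum_const]
    refine (Finset.sum_le_sum fun p hp => ?_).trans
      (Finset.sum_le_univ_sum_of_nonneg fun p => gapWeight_nonneg μ L p.1 p.2 g)
    obtain ⟨γ, rfl, hγ, hpos, hsum⟩ := hS p hp
    rw [gapWeight_eq_exp μ L p.1 p.2 γ hγ hpos]
    have : (∑ t ∈ Finset.range L, (γ t : ℝ)) ≤ A := by exact_mod_cast hsum
    refine Real.exp_le_exp.mpr ?_
    nlinarith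
  have h2 := h1.trans (sum_gapWeight_le R hR L g hg)
  have h3 : (2 * (R : ℝ) ^ 2 - (max (R - g) 0 : ℤ) ^ 2) / (R : ℝ) ^ 2 ≤ 2 := by
    rw [div_le_iff₀ (by positivity)]
    nlinarith [sq_nonneg (((max (R - g) 0 : ℤ)) : ℝ)]
  rw [div_le_iff₀ (by positivity)]
  have h4 : (S.card : ℝ) ≤ 4 ^ L * Real.exp (-(L / (4 * (R : ℝ) ^ 2))) * 2 * Real.exp (μ * A) := by
    have e : (S.card : ℝ) = S.card * Real.exp (-μ * A) * Real.exp (μ * A) := by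
      rw [mul_assoc, ← Real.exp_add]; simp
    rw [e]
    refine mul_le_mul_of_nonneg_right (h2.trans ?_) (Real.exp_pos _).le
    exact mul_le_mul_of_nonneg_left h3 (by positivity)
  refine h4.trans ?_
  have h5 : Real.exp (-(L / (4 * (R : ℝ) ^ 2))) * Real.exp (μ * A) ≤
      Real.exp (-(L / (8 * (R : ℝ) ^ 2))) := by
    rw [← Real.exp_add]
    refine Real.exp_le_exp.mpr ?_
    have hA' : (2 : ℝ) * A ≤ L * R := by exact_mod_cast hA
    have : μ * A ≤ L / (8 * (R : ℝ) ^ 2) := by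
      rw [hμ, le_div_iff₀ (by positivity)]
      field_simp
      nlinarith
    have e : (L : ℝ) / (4 * (R : ℝ) ^ 2) = 2 * (L / (8 * (R : ℝ) ^ 2)) := by field_simp; ring
    linarith
  nlinarith [pow_pos (show (0 : ℝ) < 4 by norm_num) L]

/-! ### Cycles and gaps -/

section Dynamics

variable {n m : ℕ}

/-- The number of steps to the east among the first `t` steps from `v`. -/
def eastCount (σ : Forest n m) (v : Torus n m) (t : ℕ) : ℕ :=
  ((Finset.range t).filter fun i => σ ((next σ)^[i] v) = true).card

theorem eastCount_le (σ : Forest n m) (v : Torus n m) (t : ℕ) : eastCount σ v t ≤ t := by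
  simpa [eastCount] using
    Finset.card_filter_le (Finset.range t) fun i => σ ((next σ)^[i] v) = true

theorem eastCount_succ (σ : Forest n m) (v : Torus n m) (t : ℕ) :
    eastCount σ v (t + 1) = eastCount σ v t + if σ ((next σ)^[t] v) = true then 1 else 0 := by
  rw [eastCount, Finset.range_add_one, Finset.filter_insert]
  split_ifs with h
  · rw [Finset.card_insert_of_notMem (by simp), eastCount]
  · rw [eastCount, add_zero]

theorem iterate_next_eq (σ : Forest n m) (v : Torus n m) (t : ℕ) :
    (next σ)^[t] v = (v.1 + (eastCount σ v t : ZMod n),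
      v.2 + ((t - eastCount σ v t : ℕ) : ZMod m)) := by
  induction t with
  | zero => simp [eastCount]
  | succ t ih =>
    have hle := eastCount_le σ v t
    rw [Function.iterate_succ_apply', eastCount_succ]
    by_cases h : σ ((next σ)^[t] v) = true
    · rw [next, if_pos h, if_pos h, ih, show t + 1 - (eastCount σ v t + 1) =
        t - eastCount σ v t by omega]
      simp [add_assoc]
    · rw [next, if_neg h, if_neg h, ih, add_zero, show t + 1 - eastCount σ v t =
        t - eastCount σ v t + 1 by omega]
      simp [add_assoc]

theorem card_filter_bits (σ : Forest n m) (v : Torus n m) (L : ℕ) :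
    (Finset.univ.filter fun i => bits σ v L i = true).card = eastCount σ v L := by
  rw [eastCount, Finset.card_filter, Finset.card_filter, Finset.sum_range]
  rfl

theorem dvd_of_isPeriodicPt {σ : Forest n m} {v : Torus n m} {L : ℕ}
    (h : Function.IsPeriodicPt (next σ) L v) :
    n ∣ eastCount σ v L ∧ m ∣ L - eastCount σ v L := by
  have h1 : (next σ)^[L] v = v := h
  rw [iterate_next_eq] at h1
  have ha := congrArg Prod.fst h1
  have hb := congrArg Prod.snd h1
  simp only [add_eq_left] at ha hb
  exact ⟨(ZMod.natCast_eq_zero_iff _ _).mp ha, (ZMod.natCast_eq_zero_iff _ _).mp hb⟩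

/-- A closed trajectory with some step to the east visits the column `x = 0`. -/
theorem exists_iterate_fst_eq_zero [NeZero n] {σ : Forest n m} {v : Torus n m} {L : ℕ}
    (h : Function.IsPeriodicPt (next σ) L v) (h0 : eastCount σ v L ≠ 0) :
    ∃ t, ((next σ)^[t] v).1 = 0 := by
  have hn : n ≤ eastCount σ v L := Nat.le_of_dvd (Nat.pos_of_ne_zero h0) (dvd_of_isPeriodicPt h).1
  -- A discrete intermediate value argument: the count grows by at most one per step.
  have key : ∀ k t, k ≤ eastCount σ v t → ∃ t', eastCount σ v t' = k := by
    intro k t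
    induction t with
    | zero =>
      intro hk
      exact ⟨0, by simp [eastCount] at hk ⊢; omega⟩
    | succ t ih =>
      intro hk
      rcases hk.lt_or_eq with hlt | heq
      · refine ih ?_
        rw [eastCount_succ] at hlt
        split_ifs at hlt <;> omega
      · exact ⟨t + 1, heq.symm⟩
  obtain ⟨t, ht⟩ := key (n - v.1.val) L (by omega)
  refine ⟨t, ?_⟩
  rw [iterate_next_eq, ht, Nat.cast_sub (ZMod.val_lt _).le]
  simp

/-- The vertex `g` steps further along the antidiagonal. -/
def shift (v : Torus n m) (g : ℤ) : Torus n m := (v.1 + (g : ZMod n), v.2 - (g : ZMod m))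

theorem shift_shift (v : Torus n m) (g h : ℤ) : shift (shift v g) h = shift v (g + h) := by
  simp [shift, add_assoc, sub_sub]

@[simp]
theorem shift_zero (v : Torus n m) : shift v 0 = v := by simp [shift]

/-- The vertex of `C` that follows `v` on its antidiagonal is `g` steps away. -/
def IsGap (C : Set (Torus n m)) (v : Torus n m) (g : ℤ) : Prop :=
  1 ≤ g ∧ v ∈ C ∧ shift v g ∈ C ∧ ∀ i, 0 < i → i < g → shift v i ∉ C

theorem next_shift (σ : Forest n m) (v : Torus n m) (g : ℤ) :
    next σ (shift v g) = shift (next σ v) (g + gapStep (σ v) (σ (shift v g))) := by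
  rcases hv : σ v with _ | _ <;> rcases hw : σ (shift v g) with _ | _ <;>
    simp only [next, hv, hw, gapStep, if_true, Bool.false_eq_true, if_false] <;>
    ext <;> simp only [shift] <;> push_cast <;> ring

theorem eq_shift_of_next_eq {σ : Forest n m} {u v : Torus n m} {i : ℤ}
    (h : next σ u = shift (next σ v) i) : u = shift v (i - gapStep (σ v) (σ u)) := by
  rcases hv : σ v with _ | _ <;> rcases hu : σ u with _ | _ <;>
    simp only [next, hv, hu, gapStep, shift, if_true, Bool.false_eq_true, if_false,
      Prod.ext_iff] at h ⊢ <;>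
    obtain ⟨h1, h2⟩ := h <;> push_cast <;> constructor <;>
    first | linear_combination h1 | linear_combination h2

/-- Order along the antidiagonal is preserved. A vertex of `C` strictly between the two images has a
preimage in `C`, on the antidiagonal of `v` at offset `j`; since steps change offsets by at most
one, `j` would have to lie strictly between `0` and `g`. -/
theorem IsGap.next {σ : Forest n m} {C : Set (Torus n m)} (hC : Set.BijOn (next σ) C C)
    {v : Torus n m} {g : ℤ} (h : IsGap C v g) (hne : CRSF.next σ (shift v g) ≠ CRSF.next σ v) :
    IsGap C (CRSF.next σ v) (g + gapStep (σ v) (σ (shift v g))) := by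
  obtain ⟨h1, hv, hw, hi⟩ := h
  have hs := next_shift σ v g
  have hb : ∀ b b' : Bool, -1 ≤ gapStep b b' ∧ gapStep b b' ≤ 1 := by decide
  refine ⟨?_, hC.mapsTo hv, hs ▸ hC.mapsTo hw, ?_⟩
  · have := (hb (σ v) (σ (shift v g))).1
    rcases (show 0 ≤ g + gapStep (σ v) (σ (shift v g)) by omega).lt_or_eq with hlt | heq
    · omega
    · rw [← heq, shift_zero] at hs
      exact absurd hs hne
  · intro i hi0 hig hmem
    obtain ⟨u, hu, hui⟩ := hC.surjOn hmem
    have hus := eq_shift_of_next_eq hui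
    set j := i - gapStep (σ v) (σ u) with hj
    have hbu := hb (σ v) (σ u)
    rcases lt_trichotomy j 0 with hj0 | hj0 | hj0
    · omega
    · rw [hj0, shift_zero] at hus
      have : gapStep (σ v) (σ u) = 0 := by rw [hus, gapStep, sub_self]
      omega
    · rcases lt_trichotomy j g with hjg | hjg | hjg
      · exact hi j hj0 hjg (hus ▸ hu)
      · rw [hjg] at hus
        rw [← hus] at hig
        omega
      · have : ∀ b b' b'' : Bool, gapStep b b' - gapStep b b'' ≤ 1 := by decide
        have := this (σ v) (σ (shift v g)) (σ u)
        omega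

/-- The half-open antidiagonal segments from `u t` of length `γ t` are pairwise disjoint, since an
overlap would put a vertex of `C` inside a gap. Together they fit into the `n m` vertices. -/
theorem sum_gap_le [NeZero n] [NeZero m] {C : Set (Torus n m)} {L : ℕ} (u : ℕ → Torus n m)
    (hu : Set.InjOn u (Set.Iio L)) (γ : ℕ → ℤ) (h : ∀ t < L, IsGap C (u t) (γ t)) :
    ∑ t ∈ Finset.range L, γ t ≤ n * m := by
  have hcard := Finset.card_le_card_of_injOn
    (s := (Finset.range L).sigma fun t => Finset.range (γ t).toNat)
    (t := (Finset.univ : Finset (Torus n m))) (fun p => shift (u p.1) (p.2 : ℤ))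
    (fun _ _ => by simp) (by
      have key : ∀ t t' i i' : ℕ, t < L → t' < L → i' < (γ t').toNat → i ≤ i' →
          shift (u t) (i : ℤ) = shift (u t') (i' : ℤ) → t = t' ∧ i = i' := by
        intro t t' i i' ht ht' hi' hii' heq
        have h1 : u t = shift (u t') ((i' : ℤ) - i) := by
          have := congrArg (fun x => shift x (-(i : ℤ))) heq
          simpa [shift_shift, sub_eq_add_neg] using this
        rcases hii'.lt_or_eq with hlt | rfl
        · exact absurd (h1 ▸ (h t ht).2.1) ((h t' ht').2.2.2 _ (by omega) (by omega))
        · rw [sub_self, shift_zero] at h1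
          exact ⟨hu ht ht' h1, rfl⟩
      rintro ⟨t, i⟩ hp ⟨t', i'⟩ hp' heq
      simp only [Finset.coe_sigma, Set.mem_sigma_iff, Finset.mem_coe, Finset.mem_range] at hp hp'
      simp only at heq
      rcases le_total i i' with hii | hii
      · obtain ⟨rfl, rfl⟩ := key t t' i i' hp.1 hp'.1 hp'.2 hii heq
        rfl
      · obtain ⟨rfl, rfl⟩ := key t' t i' i hp'.1 hp.1 hp.2 hii heq.symm
        rfl)
  rw [Finset.card_sigma, Finset.card_univ, Fintype.card_prod, ZMod.card, ZMod.card] at hcard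
  simp only [Finset.card_range] at hcard
  have e : ∑ t ∈ Finset.range L, γ t = ((∑ t ∈ Finset.range L, (γ t).toNat : ℕ) : ℤ) := by
    push_cast
    refine Finset.sum_congr rfl fun t ht => ?_
    have := (h t (Finset.mem_range.mp ht)).1
    omega
  rw [e]
  exact_mod_cast hcard

theorem exists_shift_eq_iterate [NeZero n] [NeZero m] (σ : Forest n m) (v w : Torus n m) :
    ∃ t : ℕ, ∃ j : ℕ, 1 ≤ j ∧ shift v (j : ℤ) = (next σ)^[t] w := by
  set a := (v.1 - w.1).val with ha
  set b := (v.2 - w.2).val with hb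
  have ha' : (a : ZMod n) = v.1 - w.1 := ZMod.natCast_zmod_val _
  have hb' : (b : ZMod m) = v.2 - w.2 := ZMod.natCast_zmod_val _
  have hn := NeZero.pos n
  have hm := NeZero.pos m
  obtain ⟨K, hK⟩ : ∃ K : ℕ, n * m = K + 1 := ⟨n * m - 1, by have := Nat.mul_pos hn hm; omega⟩
  have hle := eastCount_le σ w (a + b)
  -- `K = n m - 1` is `-1` modulo both `n` and `m`, so it stands for a subtraction of `a`; the extra
  -- `n m` only makes the offset positive.
  refine ⟨a + b, eastCount σ w (a + b) + a * K + n * m, by have := Nat.mul_pos hn hm; omega, ?_⟩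
  rw [iterate_next_eq]
  have hKn : (K : ZMod n) = -1 := by
    have : ((K + 1 : ℕ) : ZMod n) = 0 := by rw [← hK]; simp
    push_cast at this
    linear_combination this
  have hKm : (K : ZMod m) = -1 := by
    have : ((K + 1 : ℕ) : ZMod m) = 0 := by rw [← hK]; simp
    push_cast at this
    linear_combination this
  ext
  · simp only [shift]
    push_cast
    rw [hKn, ha']
    simp
    ring_nf
  · simp only [shift]
    push_cast [Nat.cast_sub hle]
    rw [hKm, hb']
    simp
    ring_nf

end Dynamics

/-! ### The union bound -/

theorem injective_iterate_fin {n m : ℕ} {σ : Forest n m} {v : Torus n m} {L : ℕ}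
    (hL : L ≤ Function.minimalPeriod (next σ) v) :
    Function.Injective (fun i : Fin L => (next σ)^[i] v) := by
  intro i j h
  exact Fin.ext (Function.iterate_injOn_Iio_minimalPeriod
    (Set.mem_Iio.mpr (by omega)) (Set.mem_Iio.mpr (by omega)) h)

theorem IsCycle.exists_minimalPeriod {n m : ℕ} {σ : Forest n m} {c : Set (Torus n m)} (hc : IsCycle σ c) :
    ∃ L, 0 < L ∧ ∀ v ∈ c, v ∈ Function.periodicPts (next σ) ∧
      Function.minimalPeriod (next σ) v = L := by
  obtain ⟨v, hv, rfl⟩ := hc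
  refine ⟨_, Function.minimalPeriod_pos_of_mem_periodicPts hv, ?_⟩
  rintro _ ⟨k, rfl⟩
  exact ⟨(Function.bijOn_periodicPts (next σ)).mapsTo.iterate k hv,
    Function.minimalPeriod_apply_iterate hv k⟩

theorem IsCycle.bijOn {n m : ℕ} {σ : Forest n m} {c : Set (Torus n m)} (hc : IsCycle σ c) :
    Set.BijOn (next σ) c c := by
  obtain ⟨v, hv, rfl⟩ := hc
  have hsub : (Set.range fun k : ℕ => (next σ)^[k] v) ⊆ Function.periodicPts (next σ) := by
    rintro _ ⟨k, rfl⟩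
    exact (Function.bijOn_periodicPts (next σ)).mapsTo.iterate k hv
  refine ⟨?_, (Function.bijOn_periodicPts (next σ)).injOn.mono hsub, ?_⟩
  · rintro _ ⟨k, rfl⟩
    exact ⟨k + 1, Function.iterate_succ_apply' _ _ _⟩
  · rintro _ ⟨k, rfl⟩
    have hp := Function.minimalPeriod_pos_of_mem_periodicPts hv
    refine ⟨(next σ)^[k + (Function.minimalPeriod (next σ) v - 1)] v, ⟨_, rfl⟩, ?_⟩
    rw [← Function.iterate_succ_apply' (next σ), show (k + (Function.minimalPeriod (next σ) v - 1)).succ =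
      k + Function.minimalPeriod (next σ) v by omega, Function.iterate_add_apply,
      Function.isPeriodicPt_minimalPeriod (next σ) v]

section UnionBound

variable {n m : ℕ} [NeZero n] [NeZero m]

/-- The trajectory of `v` has `L` distinct vertices, followed by `a` steps to the east. -/
def pathEvent (v : Torus n m) (L a : ℕ) : Set (Forest n m) :=
  {σ | Function.Injective (fun i : Fin L => (next σ)^[i] v) ∧ eastCount σ v L = a}

/-- The trajectories of `v` and `shift v g` are disjoint for `L` steps, and the gap between them
stays positive and has a sum of at most `A`. -/
def gapEvent (v : Torus n m) (g : ℤ) (L A : ℕ) : Set (Forest n m) :=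
  {σ | Function.Injective (fun i : Fin L => (next σ)^[i] v) ∧
    Function.Injective (fun i : Fin L => (next σ)^[i] (shift v g)) ∧
    (∀ i j : Fin L, (next σ)^[i] v ≠ (next σ)^[j] (shift v g)) ∧
    ∃ γ : ℕ → ℤ, γ 0 = g ∧
      (∀ t : Fin L, γ (t + 1) = γ t + gapStep (bits σ v L t) (bits σ (shift v g) L t)) ∧
      (∀ t ≤ L, 1 ≤ γ t) ∧ ∑ t ∈ Finset.range L, γ t ≤ A}

theorem crsfMeasure_real_pathEvent_le (v : Torus n m) (L a : ℕ) :
    (crsfMeasure n m).real (pathEvent v L a) ≤ L.choose a / 2 ^ L := by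
  classical
  refine le_trans (measureReal_mono ?_ (measure_ne_top _ _)) ((crsfMeasure_real_single_le v L
    (Finset.univ.filter fun s : Fin L → Bool =>
      (Finset.univ.filter fun i => s i = true).card = a)).trans ?_)
  · rintro σ ⟨h1, h2⟩
    refine ⟨h1, ?_⟩
    rw [Finset.mem_filter, card_filter_bits]
    exact ⟨Finset.mem_univ _, h2⟩
  · have := card_filter_card_true L a
    gcongr

theorem crsfMeasure_real_gapEvent_le (v : Torus n m) (g : ℤ) (hg : 0 ≤ g) (L A R : ℕ) (hR : 1 ≤ R)
    (hA : 2 * A ≤ L * R) :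
    (crsfMeasure n m).real (gapEvent v g L A) ≤ 2 * Real.exp (-(L / (8 * (R : ℝ) ^ 2))) := by
  classical
  refine le_trans (measureReal_mono ?_ (measure_ne_top _ _))
    ((crsfMeasure_real_pair_le v (shift v g) L
    (Finset.univ.filter fun p : (Fin L → Bool) × (Fin L → Bool) =>
      ∃ γ : ℕ → ℤ, γ 0 = g ∧ (∀ t : Fin L, γ (t + 1) = γ t + gapStep (p.1 t) (p.2 t)) ∧
      (∀ t ≤ L, 1 ≤ γ t) ∧ ∑ t ∈ Finset.range L, γ t ≤ A)).trans
      (card_gap_le R hR L A hA g hg _ fun p hp => (Finset.mem_filter.mp hp).2))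
  rintro σ ⟨h1, h2, h3, h4⟩
  exact ⟨h1, h2, h3, Finset.mem_filter.mpr ⟨Finset.mem_univ _, h4⟩⟩

theorem minimalPeriod_next_le (σ : Forest n m) (v : Torus n m) :
    Function.minimalPeriod (next σ) v ≤ n * m := by
  have := Fintype.card_le_of_injective _
    (injective_iterate_fin (le_refl (Function.minimalPeriod (next σ) v)))
  simpa [ZMod.card] using this

/-- Starting on the column `x = 0` whenever there is an east step saves a factor `n` in the union
bound. -/
theorem exists_pathEvent {σ : Forest n m} {v : Torus n m}
    (hv : v ∈ Function.periodicPts (next σ)) :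
    ∃ u : Torus n m, ∃ a b : ℕ, n ∣ a ∧ m ∣ b ∧ a + b = Function.minimalPeriod (next σ) v ∧
      σ ∈ pathEvent u (a + b) a ∧ (a ≠ 0 → u.1 = 0) := by
  have key : ∀ u : Torus n m, Function.minimalPeriod (next σ) u =
      Function.minimalPeriod (next σ) v →
      (eastCount σ u (Function.minimalPeriod (next σ) v) ≠ 0 → u.1 = 0) →
      ∃ u : Torus n m, ∃ a b : ℕ, n ∣ a ∧ m ∣ b ∧ a + b = Function.minimalPeriod (next σ) v ∧
      σ ∈ pathEvent u (a + b) a ∧ (a ≠ 0 → u.1 = 0) := by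
    intro u hu h0
    have hp := Function.isPeriodicPt_minimalPeriod (next σ) u
    rw [hu] at hp
    have hd := dvd_of_isPeriodicPt hp
    have e := Nat.add_sub_cancel' (eastCount_le σ u (Function.minimalPeriod (next σ) v))
    refine ⟨u, _, _, hd.1, hd.2, e, ?_, h0⟩
    rw [e]
    exact ⟨injective_iterate_fin hu.ge, rfl⟩
  by_cases h0 : eastCount σ v (Function.minimalPeriod (next σ) v) = 0
  · exact key v rfl fun h => absurd h0 h
  · obtain ⟨t, ht⟩ := exists_iterate_fst_eq_zero (Function.isPeriodicPt_minimalPeriod (next σ) v) h0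
    exact key _ (Function.minimalPeriod_apply_iterate hv t) fun _ => ht

theorem exists_gapEvent {σ : Forest n m} {c₁ c₂ : Set (Torus n m)} (hc₁ : IsCycle σ c₁)
    (hc₂ : IsCycle σ c₂) (hd : Disjoint c₁ c₂) {L : ℕ} (hL : 0 < L)
    (h₁ : ∀ v ∈ c₁, Function.minimalPeriod (next σ) v = L)
    (h₂ : ∀ v ∈ c₂, L ≤ Function.minimalPeriod (next σ) v) :
    ∃ v : Torus n m, ∃ g : ℕ, g ∈ Finset.Icc 1 (n * m) ∧ σ ∈ gapEvent v g L (n * m) := by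
  classical
  have hb₁ := hc₁.bijOn
  have hb₂ := hc₂.bijOn
  -- The offset is minimized over all `v ∈ c₁` at once: a vertex of `c₁` at offset `i` inside the
  -- gap would give the smaller value `g - i`, and a vertex of `c₂` there would give `i`.
  have hex : ∃ j : ℕ, 1 ≤ j ∧ ∃ v ∈ c₁, shift v (j : ℤ) ∈ c₂ := by
    obtain ⟨v, -, rfl⟩ := id hc₁
    obtain ⟨w, -, rfl⟩ := id hc₂
    obtain ⟨t, j, hj, h⟩ := exists_shift_eq_iterate σ v w
    exact ⟨j, hj, v, ⟨0, rfl⟩, t, h.symm⟩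
  obtain ⟨hg1, v, hv, hw⟩ := Nat.find_spec hex
  have hmin := fun j => Nat.find_min (H := hex) (m := j)
  set g := Nat.find hex
  have hC : Set.BijOn (next σ) (c₁ ∪ c₂) (c₁ ∪ c₂) := by
    refine hb₁.union hb₂ ?_
    rw [Set.injOn_union hd]
    refine ⟨hb₁.injOn, hb₂.injOn, fun x hx y hy h => ?_⟩
    exact Set.disjoint_left.mp hd (hb₁.mapsTo hx) (h ▸ hb₂.mapsTo hy)
  have hgap0 : IsGap (c₁ ∪ c₂) v g := by
    refine ⟨by exact_mod_cast hg1, Or.inl hv, Or.inr hw, ?_⟩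
    intro i hi0 hig
    lift i to ℕ using hi0.le
    rintro (h | h)
    · refine hmin (g - i) (by omega) ⟨by omega, _, h, ?_⟩
      rw [shift_shift, Nat.cast_sub (by omega)]
      simpa using hw
    · exact hmin i (by omega) ⟨by omega, v, hv, h⟩
  have hv_mem : ∀ t, (next σ)^[t] v ∈ c₁ := fun t => hb₁.mapsTo.iterate t hv
  have hw_mem : ∀ t, (next σ)^[t] (shift v g) ∈ c₂ := fun t => hb₂.mapsTo.iterate t hw
  set γ : ℕ → ℤ := fun t => g + ∑ i ∈ Finset.range t,
    gapStep (σ ((next σ)^[i] v)) (σ ((next σ)^[i] (shift v g))) with hγ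
  have hγ_succ : ∀ t, γ (t + 1) = γ t +
      gapStep (σ ((next σ)^[t] v)) (σ ((next σ)^[t] (shift v g))) := by
    intro t
    simp only [hγ, Finset.sum_range_succ]
    ring
  have hgap : ∀ t, IsGap (c₁ ∪ c₂) ((next σ)^[t] v) (γ t) ∧
      shift ((next σ)^[t] v) (γ t) = (next σ)^[t] (shift v g) := by
    intro t
    induction t with
    | zero => simpa [hγ] using hgap0
    | succ t ih =>
      obtain ⟨ih1, ih2⟩ := ih
      have hne : next σ (shift ((next σ)^[t] v) (γ t)) ≠ next σ ((next σ)^[t] v) := by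
        intro h
        rw [ih2] at h
        exact Set.disjoint_left.mp hd (hb₁.mapsTo (hv_mem t)) (h ▸ hb₂.mapsTo (hw_mem t))
      have h1 := ih1.next hC hne
      have h2 := next_shift σ ((next σ)^[t] v) (γ t)
      rw [ih2, ← hγ_succ, ← Function.iterate_succ_apply' (next σ), ← Function.iterate_succ_apply' (next σ)] at h2
      rw [ih2, ← hγ_succ, ← Function.iterate_succ_apply' (next σ)] at h1
      exact ⟨h1, h2.symm⟩
  have hγ_pos : ∀ t, 1 ≤ γ t := fun t => (hgap t).1.1
  have hsum : ∑ t ∈ Finset.range L, γ t ≤ (n : ℤ) * m :=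
    sum_gap_le (fun t => (next σ)^[t] v)
      (by rw [← h₁ v hv]; exact Function.iterate_injOn_Iio_minimalPeriod) γ
      fun t _ => (hgap t).1
  have hγ0 : γ 0 = g := by simp [hγ]
  refine ⟨v, g, ?_, injective_iterate_fin (h₁ v hv).ge, injective_iterate_fin (h₂ _ hw), ?_, γ,
    hγ0, fun t => hγ_succ t, fun t _ => hγ_pos t, by exact_mod_cast hsum⟩
  · have := Finset.single_le_sum (f := γ) (fun t _ => by linarith [hγ_pos t])
      (Finset.mem_range.mpr hL)
    rw [hγ0] at this
    rw [Finset.mem_Icc]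
    exact ⟨hg1, by exact_mod_cast this.trans hsum⟩
  · intro i j h
    exact Set.disjoint_left.mp hd (hv_mem i) (h ▸ hw_mem j)

theorem twoDisjointCycles_cases {σ : Forest n m} (hσ : σ ∈ twoDisjointCycles n m) (ℓ : ℕ) :
    (∃ y : ZMod m, ∃ k ∈ Finset.range ℓ,
      σ ∈ pathEvent ((0, y) : Torus n m) ((k + 1) * n + (k + 1) * m) ((k + 1) * n)) ∨
    (∃ v : Torus n m, ∃ a ∈ Finset.range ℓ, ∃ b ∈ Finset.range ℓ,
      (a + b < ℓ ∧ n ∣ a ∧ m ∣ b ∧ a * m ≠ b * n) ∧ σ ∈ pathEvent v (a + b) a) ∨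
    (∃ v : Torus n m, ∃ g ∈ Finset.Icc 1 (n * m), ∃ L ∈ Finset.Icc ℓ (n * m),
      σ ∈ gapEvent v g L (n * m)) := by
  obtain ⟨c₁, c₂, hc₁, hc₂, hd⟩ := hσ
  obtain ⟨L₁, hL₁, h₁⟩ := hc₁.exists_minimalPeriod
  obtain ⟨L₂, hL₂, h₂⟩ := hc₂.exists_minimalPeriod
  wlog hle : L₁ ≤ L₂ generalizing c₁ c₂ L₁ L₂
  · exact this c₂ c₁ hc₂ hc₁ hd.symm L₂ hL₂ h₂ L₁ hL₁ h₁ (by omega)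
  obtain ⟨v, hv⟩ : c₁.Nonempty := by
    obtain ⟨v, -, rfl⟩ := hc₁
    exact ⟨v, 0, rfl⟩
  by_cases hℓ : ℓ ≤ L₁
  · right; right
    obtain ⟨u, g, hg, hmem⟩ := exists_gapEvent hc₁ hc₂ hd hL₁ (fun v hv => (h₁ v hv).2)
      (fun w hw => hle.trans (h₂ w hw).2.ge)
    exact ⟨u, g, hg, L₁, Finset.mem_Icc.mpr ⟨hℓ, (h₁ v hv).2 ▸ minimalPeriod_next_le σ v⟩, hmem⟩
  · obtain ⟨u, a, b, ha, hb, hab, hmem, hu⟩ := exists_pathEvent (h₁ v hv).1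
    rw [(h₁ v hv).2] at hab
    by_cases h : a * m = b * n
    · left
      obtain ⟨p, rfl⟩ := ha
      obtain ⟨q, rfl⟩ := hb
      have hn := NeZero.pos n
      have hm := NeZero.pos m
      have hpq : p = q := by
        have : n * m * p = n * m * q := by linarith
        exact Nat.eq_of_mul_eq_mul_left (Nat.mul_pos hn hm) this
      subst hpq
      have hp : p ≠ 0 := by
        rintro rfl
        simp at hab
        omega
      have hu0 := hu (Nat.mul_ne_zero hn.ne' hp)
      obtain ⟨k, rfl⟩ := Nat.exists_eq_succ_of_ne_zero hp
      refine ⟨u.2, k, Finset.mem_range.mpr ?_, ?_⟩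
      · have : k + 1 ≤ n * (k + 1) := Nat.le_mul_of_pos_left _ hn
        rw [Nat.succ_eq_add_one] at hab
        omega
      · rw [← hu0, mul_comm _ n, mul_comm _ m]
        exact hmem
    · right; left
      exact ⟨u, a, Finset.mem_range.mpr (by omega), b, Finset.mem_range.mpr (by omega),
        ⟨by omega, ha, hb, h⟩, hmem⟩

theorem measureReal_le_card_mul {Ω β : Type*} [MeasurableSpace Ω] (μ : Measure Ω)
    [IsFiniteMeasure μ] (s : Finset β) (A : Set Ω) (f : β → Set Ω) (hA : ∀ ω ∈ A, ∃ b ∈ s, ω ∈ f b)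
    (x : ℝ) (hx : ∀ b ∈ s, μ.real (f b) ≤ x) : μ.real A ≤ s.card * x := by
  calc μ.real A ≤ μ.real (⋃ b ∈ s, f b) :=
        measureReal_mono (fun ω hω => by simpa using hA ω hω) (measure_ne_top _ _)
    _ ≤ ∑ b ∈ s, μ.real (f b) := measureReal_biUnion_finset_le _ _
    _ ≤ ∑ b ∈ s, x := Finset.sum_le_sum hx
    _ = _ := by rw [Finset.sum_const, nsmul_eq_mul]

theorem crsfMeasure_real_twoDisjointCycles_le (ℓ R : ℕ) (hR : 1 ≤ R) (hℓ : 2 * (n * m) ≤ ℓ * R)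
    (x : ℝ) (hx0 : 0 ≤ x) (hx : ∀ a b : ℕ, a + b < ℓ → n ∣ a → m ∣ b → a * m ≠ b * n →
      (Nat.choose (a + b) a : ℝ) / 2 ^ (a + b) ≤ x) :
    (crsfMeasure n m).real (twoDisjointCycles n m) ≤
      m * ∑ k ∈ Finset.range ℓ, ((Nat.choose ((k + 1) * n + (k + 1) * m) ((k + 1) * n) : ℝ) /
        2 ^ ((k + 1) * n + (k + 1) * m)) +
      n * m * (ℓ * (ℓ * x)) +
      n * m * (n * m * (n * m * (2 * Real.exp (-(ℓ / (8 * (R : ℝ) ^ 2)))))) := by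
  set μ := crsfMeasure n m with hμ
  have hn := NeZero.pos n
  have hm := NeZero.pos m
  set A₁ : Set (Forest n m) := {σ | ∃ y : ZMod m, ∃ k ∈ Finset.range ℓ,
      σ ∈ pathEvent ((0, y) : Torus n m) ((k + 1) * n + (k + 1) * m) ((k + 1) * n)} with hA₁
  set A₂ : Set (Forest n m) := {σ | ∃ v : Torus n m, ∃ a ∈ Finset.range ℓ, ∃ b ∈ Finset.range ℓ,
      (a + b < ℓ ∧ n ∣ a ∧ m ∣ b ∧ a * m ≠ b * n) ∧ σ ∈ pathEvent v (a + b) a} with hA₂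
  set A₃ : Set (Forest n m) := {σ | ∃ v : Torus n m, ∃ g ∈ Finset.Icc 1 (n * m),
      ∃ L ∈ Finset.Icc ℓ (n * m), σ ∈ gapEvent v g L (n * m)} with hA₃
  have hsub : twoDisjointCycles n m ⊆ A₁ ∪ A₂ ∪ A₃ := fun σ hσ => by
    rcases twoDisjointCycles_cases hσ ℓ with h | h | h
    exacts [Or.inl (Or.inl h), Or.inl (Or.inr h), Or.inr h]
  have h₁ : μ.real A₁ ≤ m * ∑ k ∈ Finset.range ℓ,
      ((Nat.choose ((k + 1) * n + (k + 1) * m) ((k + 1) * n) : ℝ) /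
        2 ^ ((k + 1) * n + (k + 1) * m)) := by
    have := measureReal_le_card_mul μ (Finset.univ : Finset (ZMod m)) A₁
      (fun y => ⋃ k ∈ Finset.range ℓ,
        pathEvent ((0, y) : Torus n m) ((k + 1) * n + (k + 1) * m) ((k + 1) * n))
      (fun σ ⟨y, k, hk, h⟩ => ⟨y, Finset.mem_univ _, Set.mem_biUnion hk h⟩) _ fun y _ =>
        (measureReal_biUnion_finset_le _ _).trans
          (Finset.sum_le_sum fun k _ => crsfMeasure_real_pathEvent_le _ _ _)
    rwa [Finset.card_univ, ZMod.card] at this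
  have hcard : ((Finset.univ : Finset (Torus n m)).card : ℝ) = n * m := by
    rw [Finset.card_univ, Fintype.card_prod, ZMod.card, ZMod.card, Nat.cast_mul]
  have h₂ : μ.real A₂ ≤ n * m * (ℓ * (ℓ * x)) := by
    rw [← hcard]
    refine measureReal_le_card_mul μ _ A₂ (fun v => {σ | ∃ a ∈ Finset.range ℓ,
      ∃ b ∈ Finset.range ℓ, (a + b < ℓ ∧ n ∣ a ∧ m ∣ b ∧ a * m ≠ b * n) ∧
        σ ∈ pathEvent v (a + b) a}) (fun σ ⟨v, h⟩ => ⟨v, Finset.mem_univ _, h⟩) _ fun v _ => ?_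
    have := measureReal_le_card_mul μ (Finset.range ℓ) _ (fun a => {σ |
      ∃ b ∈ Finset.range ℓ, (a + b < ℓ ∧ n ∣ a ∧ m ∣ b ∧ a * m ≠ b * n) ∧
        σ ∈ pathEvent v (a + b) a}) (fun σ h => h) (ℓ * x) fun a _ => ?_
    · rwa [Finset.card_range] at this
    have := measureReal_le_card_mul μ (Finset.range ℓ) _ (fun b => {σ |
      (a + b < ℓ ∧ n ∣ a ∧ m ∣ b ∧ a * m ≠ b * n) ∧
        σ ∈ pathEvent v (a + b) a}) (fun σ h => h) x fun b _ => ?_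
    · rwa [Finset.card_range] at this
    by_cases h : a + b < ℓ ∧ n ∣ a ∧ m ∣ b ∧ a * m ≠ b * n
    · refine (measureReal_mono (fun σ hσ => hσ.2) (measure_ne_top _ _)).trans
        ((crsfMeasure_real_pathEvent_le v (a + b) a).trans (hx a b h.1 h.2.1 h.2.2.1 h.2.2.2))
    · have e : {σ : Forest n m | (a + b < ℓ ∧ n ∣ a ∧ m ∣ b ∧ a * m ≠ b * n) ∧
          σ ∈ pathEvent v (a + b) a} = ∅ := Set.eq_empty_of_forall_notMem fun σ hσ => h hσ.1
      rw [e, measureReal_empty]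
      exact hx0
  have h₃ : μ.real A₃ ≤ n * m * (n * m * (n * m * (2 * Real.exp (-(ℓ / (8 * (R : ℝ) ^ 2)))))) := by
    rw [← hcard]
    refine measureReal_le_card_mul μ _ A₃ (fun v => {σ | ∃ g ∈ Finset.Icc 1 (n * m),
      ∃ L ∈ Finset.Icc ℓ (n * m), σ ∈ gapEvent v g L (n * m)})
      (fun σ ⟨v, h⟩ => ⟨v, Finset.mem_univ _, h⟩) _ fun v _ => ?_
    rw [hcard]
    have := measureReal_le_card_mul μ (Finset.Icc 1 (n * m)) _ (fun g => {σ |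
      ∃ L ∈ Finset.Icc ℓ (n * m), σ ∈ gapEvent v g L (n * m)}) (fun σ h => h)
      (n * m * (2 * Real.exp (-(ℓ / (8 * (R : ℝ) ^ 2))))) fun g _ => ?_
    · rwa [Nat.card_Icc, Nat.add_sub_cancel, Nat.cast_mul] at this
    have := measureReal_le_card_mul μ (Finset.Icc ℓ (n * m)) _ (fun L => gapEvent v g L (n * m))
      (fun σ h => h) (2 * Real.exp (-(ℓ / (8 * (R : ℝ) ^ 2)))) fun L hL => ?_
    · refine this.trans (mul_le_mul_of_nonneg_right ?_ (by positivity))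
      rw [← Nat.cast_mul, Nat.card_Icc]
      -- The interval from `ℓ` to `n m` has `n m + 1 - ℓ` elements, so the bound `n m` needs `ℓ ≥
      -- 1`.
      have : 0 < ℓ := by
        rcases Nat.eq_zero_or_pos ℓ with rfl | h
        · have := Nat.mul_pos hn hm
          omega
        · exact h
      exact_mod_cast (by omega : n * m + 1 - ℓ ≤ n * m)
    have hℓL := (Finset.mem_Icc.mp hL).1
    refine (crsfMeasure_real_gapEvent_le v g (by omega) L (n * m) R hR
      (hℓ.trans (Nat.mul_le_mul_right _ hℓL))).trans ?_
    gcongr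
  calc μ.real (twoDisjointCycles n m) ≤ μ.real (A₁ ∪ A₂ ∪ A₃) :=
        measureReal_mono hsub (measure_ne_top _ _)
    _ ≤ μ.real A₁ + μ.real A₂ + μ.real A₃ :=
        (measureReal_union_le _ _).trans (by gcongr; exact measureReal_union_le _ _)
    _ ≤ _ := by gcongr

end UnionBound

/-! ### Asymptotics -/

section Asymptotics

variable {n m : ℕ}

/-- With `a = n p` and `b = m q`, `a - b = n (p - q) - q (m - n)`. Here `|p - q| ≥ 1`, while `q ≤ 2
n ^ (2/5)` keeps the second term within `n / 2`. -/
theorem exp_neg_le_of_dvd (hn : 1 ≤ n) (hm : 2 * |(m : ℝ) - n| ≤ (n : ℝ))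
    (hmn : |(m : ℝ) - n| ≤ (n : ℝ) ^ (3 / 5 : ℝ) / 4) {a b : ℕ}
    (hab : ((a + b : ℕ) : ℝ) ≤ (n : ℝ) ^ (7 / 5 : ℝ)) (ha : n ∣ a) (hb : m ∣ b)
    (hne : a * m ≠ b * n) :
    (Nat.choose (a + b) a : ℝ) / 2 ^ (a + b) ≤ Real.exp (-((n : ℝ) ^ (3 / 5 : ℝ) / 16)) := by
  have hn0 : (0 : ℝ) < n := by exact_mod_cast hn
  refine (choose_div_two_pow_le_exp a b).trans (Real.exp_le_exp.mpr (neg_le_neg ?_))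
  have hmax : ((max a b : ℕ) : ℝ) ≤ (n : ℝ) ^ (7 / 5 : ℝ) :=
    le_trans (by exact_mod_cast (by omega : max a b ≤ a + b)) hab
  have hmax0 : (0 : ℝ) < (max a b : ℕ) := by
    rw [Nat.cast_pos, Nat.pos_iff_ne_zero]
    intro h
    obtain ⟨rfl, rfl⟩ : a = 0 ∧ b = 0 := by omega
    simp at hne
  obtain ⟨p, rfl⟩ := ha
  obtain ⟨q, rfl⟩ := hb
  have hpq : (p : ℤ) - q ≠ 0 := by
    intro h
    have : p = q := by omega
    subst this
    exact hne (by ring)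
  have hpq1 : (1 : ℝ) ≤ |(p : ℝ) - q| := by exact_mod_cast Int.one_le_abs hpq
  have hm2 : (n : ℝ) / 2 ≤ m := by
    have := (abs_le.mp (le_of_eq (rfl : |(m : ℝ) - n| = _))).1
    linarith
  have e75 : (n : ℝ) ^ (7 / 5 : ℝ) = n * (n : ℝ) ^ (2 / 5 : ℝ) := by
    rw [← Real.rpow_one_add' hn0.le (by norm_num)]; norm_num
  have e1 : (n : ℝ) = (n : ℝ) ^ (2 / 5 : ℝ) * (n : ℝ) ^ (3 / 5 : ℝ) := by
    rw [← Real.rpow_add hn0]; norm_num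
  have e2 : (n : ℝ) ^ 2 = (n : ℝ) ^ (7 / 5 : ℝ) * (n : ℝ) ^ (3 / 5 : ℝ) := by
    rw [← Real.rpow_add hn0, ← Real.rpow_natCast]; norm_num
  have hp25 : 0 < (n : ℝ) ^ (2 / 5 : ℝ) := by positivity
  have hp35 : 0 < (n : ℝ) ^ (3 / 5 : ℝ) := by positivity
  have hq : (q : ℝ) ≤ 2 * (n : ℝ) ^ (2 / 5 : ℝ) := by
    have h1 : (m : ℝ) * q ≤ n * (n : ℝ) ^ (2 / 5 : ℝ) := by
      rw [← e75]
      refine le_trans ?_ hab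
      push_cast
      have : (0 : ℝ) ≤ n * p := by positivity
      linarith
    have h2 : (n : ℝ) / 2 * q ≤ m * q := by gcongr
    have h3 : (n : ℝ) * q ≤ n * (2 * (n : ℝ) ^ (2 / 5 : ℝ)) := by linarith
    exact le_of_mul_le_mul_left h3 hn0
  have hdev : (n : ℝ) / 2 ≤ |((n * p : ℕ) : ℝ) - (m * q : ℕ)| := by
    have h1 : (q : ℝ) * |(m : ℝ) - n| ≤ n / 2 := by
      calc (q : ℝ) * |(m : ℝ) - n| ≤ (2 * (n : ℝ) ^ (2 / 5 : ℝ)) * ((n : ℝ) ^ (3 / 5 : ℝ) / 4) := by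
            gcongr
        _ = (n : ℝ) / 2 := by conv_rhs => rw [e1]
                              ring
    have h2 : |(n : ℝ) * ((p : ℝ) - q)| - |(q : ℝ) * ((m : ℝ) - n)| ≤
        |(n : ℝ) * ((p : ℝ) - q) - q * ((m : ℝ) - n)| := abs_sub_abs_le_abs_sub _ _
    rw [abs_mul, abs_mul, Nat.abs_cast, Nat.abs_cast] at h2
    have e : ((n * p : ℕ) : ℝ) - (m * q : ℕ) = (n : ℝ) * ((p : ℝ) - q) - q * ((m : ℝ) - n) := by
      push_cast; ring
    rw [e]
    nlinarith
  have hsq : (n : ℝ) ^ 2 / 4 ≤ (((n * p : ℕ) : ℝ) - (m * q : ℕ)) ^ 2 := by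
    rw [← sq_abs (((n * p : ℕ) : ℝ) - (m * q : ℕ))]
    have : ((n : ℝ) / 2) ^ 2 ≤ |((n * p : ℕ) : ℝ) - (m * q : ℕ)| ^ 2 := by gcongr
    linarith
  rw [le_div_iff₀ (by positivity)]
  calc (n : ℝ) ^ (3 / 5 : ℝ) / 16 * (4 * ((max (n * p) (m * q) : ℕ) : ℝ))
      ≤ (n : ℝ) ^ (3 / 5 : ℝ) / 16 * (4 * (n : ℝ) ^ (7 / 5 : ℝ)) := by gcongr
    _ = (n : ℝ) ^ 2 / 4 := by rw [e2]; ring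
    _ ≤ _ := hsq

/-- Winding `k + 1` times multiplies the squared deviation by `(k + 1)²` and the number of steps by
`k + 1`, so the Gaussian factor becomes a power and the sum is geometric. -/
theorem sum_diagonal_le (hn : 1 ≤ n) (hm : 2 * |(m : ℝ) - n| ≤ (n : ℝ)) (ℓ : ℕ) {r : ℝ}
    (hr : Real.exp (-(((m : ℝ) - n) ^ 2 / (4 * (max n m : ℕ)))) ≤ r) (hr2 : r ≤ 1 / 2) :
    (m : ℝ) * ∑ k ∈ Finset.range ℓ, ((Nat.choose ((k + 1) * n + (k + 1) * m) ((k + 1) * n) : ℝ) /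
        2 ^ ((k + 1) * n + (k + 1) * m)) ≤ 4 * Real.sqrt n * r := by
  have hn0 : (0 : ℝ) < n := by exact_mod_cast hn
  have hr0 : 0 < r := (Real.exp_pos _).trans_le hr
  have habs := abs_le.mp (show |(m : ℝ) - n| ≤ n / 2 by linarith)
  have hterm : ∀ k : ℕ, (Nat.choose ((k + 1) * n + (k + 1) * m) ((k + 1) * n) : ℝ) /
        2 ^ ((k + 1) * n + (k + 1) * m) ≤ 1 / Real.sqrt n * (r * r ^ k) := by
    intro k
    refine (choose_div_two_pow_le _ _).trans ?_
    have h1 : 1 / Real.sqrt (2 * (min ((k + 1) * n) ((k + 1) * m) : ℕ) + 1) ≤ 1 / Real.sqrt n := by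
      refine one_div_le_one_div_of_le (Real.sqrt_pos.mpr hn0) (Real.sqrt_le_sqrt ?_)
      rw [Nat.mul_min_mul_left]
      have : (n : ℝ) / 2 ≤ (min n m : ℕ) := by
        rw [Nat.cast_min]
        exact le_min (by linarith) (by linarith)
      push_cast at this ⊢
      nlinarith [Nat.cast_nonneg (α := ℝ) k, mul_nonneg (Nat.cast_nonneg (α := ℝ) k)
        (show (0 : ℝ) ≤ min (n : ℝ) m by positivity)]
    have h2 : Real.exp (-(((((k + 1) * n : ℕ) : ℝ) - ((k + 1) * m : ℕ)) ^ 2 /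
        (4 * (max ((k + 1) * n) ((k + 1) * m) : ℕ)))) ≤ r * r ^ k := by
      rw [← pow_succ']
      calc _ = Real.exp (-(((m : ℝ) - n) ^ 2 / (4 * (max n m : ℕ)))) ^ (k + 1) := by
            rw [← Real.exp_nat_mul, Nat.mul_max_mul_left]
            congr 1
            have : (0 : ℝ) < (max n m : ℕ) := by
              exact_mod_cast (by omega : 0 < max n m)
            push_cast at this ⊢
            field_simp
            ring
        _ ≤ r ^ (k + 1) := by gcongr
    gcongr
  have hgeo : ∑ k ∈ Finset.range ℓ, r ^ k ≤ 2 := by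
    refine (Summable.sum_le_tsum _ (fun k _ => by positivity)
      (summable_geometric_of_lt_one hr0.le (by linarith))).trans ?_
    rw [tsum_geometric_of_lt_one hr0.le (by linarith)]
    exact inv_le_of_inv_le₀ (by norm_num) (by linarith)
  calc _ ≤ (2 * n : ℝ) * ∑ k ∈ Finset.range ℓ, 1 / Real.sqrt n * (r * r ^ k) := by
        have : (m : ℝ) ≤ 2 * n := by linarith
        gcongr with k _
        exact hterm k
    _ = (2 * n : ℝ) / Real.sqrt n * r * ∑ k ∈ Finset.range ℓ, r ^ k := by
        rw [← Finset.mul_sum, ← Finset.mul_sum]; ring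
    _ ≤ (2 * n : ℝ) / Real.sqrt n * r * 2 := by gcongr
    _ = _ := by
        have : (n : ℝ) / Real.sqrt n = Real.sqrt n := Real.div_sqrt
        rw [mul_div_assoc, this]; ring

theorem crsfMeasure_real_twoDisjointCycles_le_of_close (hn : 1 ≤ n)
    (hmn : |(m : ℝ) - n| ≤ (n : ℝ) ^ (3 / 5 : ℝ) / 4) {r : ℝ}
    (hr : Real.exp (-(((m : ℝ) - n) ^ 2 / (4 * (max n m : ℕ)))) ≤ r) (hr2 : r ≤ 1 / 2) :
    (crsfMeasure n m).real (twoDisjointCycles n m) ≤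
      4 * Real.sqrt n * r + 24 * (n : ℝ) ^ 6 * Real.exp (-((n : ℝ) ^ (1 / 5 : ℝ) / 200)) := by
  have hn1 : (1 : ℝ) ≤ n := by exact_mod_cast hn
  have hn0 : (0 : ℝ) < n := by linarith
  have hle1 : (n : ℝ) ^ (3 / 5 : ℝ) ≤ n := by
    conv_rhs => rw [← Real.rpow_one (n : ℝ)]
    exact Real.rpow_le_rpow_of_exponent_le hn1 (by norm_num)
  have hm : 2 * |(m : ℝ) - n| ≤ (n : ℝ) := by linarith
  have habs := abs_le.mp (show |(m : ℝ) - n| ≤ n / 2 by linarith)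
  have hm0 : (0 : ℝ) < m := by linarith
  have hm2 : (m : ℝ) ≤ 2 * n := by linarith
  have : NeZero n := ⟨by omega⟩
  have : NeZero m := ⟨by rintro rfl; simp at hm0⟩
  -- The exponents are chosen so that `ℓ R ≥ 4 n² ≥ 2 n m`, while `ℓ / R²` still grows like `n ^
  -- (1/5)`.
  set ℓ := ⌈(n : ℝ) ^ (7 / 5 : ℝ)⌉₊ with hℓ
  set R := ⌈4 * (n : ℝ) ^ (3 / 5 : ℝ)⌉₊ with hR
  have h75 : (1 : ℝ) ≤ (n : ℝ) ^ (7 / 5 : ℝ) := Real.one_le_rpow hn1 (by norm_num)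
  have h35 : (1 : ℝ) ≤ (n : ℝ) ^ (3 / 5 : ℝ) := Real.one_le_rpow hn1 (by norm_num)
  have hℓ1 : (n : ℝ) ^ (7 / 5 : ℝ) ≤ ℓ := Nat.le_ceil _
  have hR1 : 4 * (n : ℝ) ^ (3 / 5 : ℝ) ≤ R := Nat.le_ceil _
  have hℓ2 : (ℓ : ℝ) ≤ 2 * (n : ℝ) ^ 2 := by
    have h1 := (Nat.ceil_lt_add_one (show 0 ≤ (n : ℝ) ^ (7 / 5 : ℝ) by positivity)).le
    have h2 : (n : ℝ) ^ (7 / 5 : ℝ) ≤ (n : ℝ) ^ 2 := by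
      rw [← Real.rpow_natCast]
      exact Real.rpow_le_rpow_of_exponent_le hn1 (by norm_num)
    nlinarith
  have hR2 : (R : ℝ) ≤ 5 * (n : ℝ) ^ (3 / 5 : ℝ) := by
    have h1 := (Nat.ceil_lt_add_one (show 0 ≤ 4 * (n : ℝ) ^ (3 / 5 : ℝ) by positivity)).le
    linarith
  have e2 : (n : ℝ) ^ 2 = (n : ℝ) ^ (7 / 5 : ℝ) * (n : ℝ) ^ (3 / 5 : ℝ) := by
    rw [← Real.rpow_add hn0, ← Real.rpow_natCast]; norm_num
  have hRpos : (0 : ℝ) < R := by linarith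
  have hRone : 1 ≤ R := by exact_mod_cast hRpos
  have hcond : 2 * (n * m) ≤ ℓ * R := by
    have : (2 : ℝ) * (n * m) ≤ ℓ * R := by
      calc (2 : ℝ) * (n * m) ≤ 2 * (n * (2 * n)) := by gcongr
        _ = (n : ℝ) ^ (7 / 5 : ℝ) * (4 * (n : ℝ) ^ (3 / 5 : ℝ)) := by linear_combination 4 * e2
        _ ≤ _ := by gcongr
    exact_mod_cast this
  have hmain := crsfMeasure_real_twoDisjointCycles_le (n := n) (m := m) ℓ R hRone hcond
    (Real.exp (-((n : ℝ) ^ (3 / 5 : ℝ) / 16))) (Real.exp_pos _).le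
    fun a b hab ha hb hne => exp_neg_le_of_dvd hn hm hmn (Nat.lt_ceil.mp hab).le ha hb hne
  refine hmain.trans ?_
  have h1 := sum_diagonal_le hn hm ℓ hr hr2
  set E := Real.exp (-((n : ℝ) ^ (1 / 5 : ℝ) / 200)) with hE
  have hE2 : Real.exp (-((n : ℝ) ^ (3 / 5 : ℝ) / 16)) ≤ E := by
    refine Real.exp_le_exp.mpr (neg_le_neg ?_)
    have : (n : ℝ) ^ (1 / 5 : ℝ) ≤ (n : ℝ) ^ (3 / 5 : ℝ) :=
      Real.rpow_le_rpow_of_exponent_le hn1 (by norm_num)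
    linarith
  have hE3 : Real.exp (-(ℓ / (8 * (R : ℝ) ^ 2))) ≤ E := by
    refine Real.exp_le_exp.mpr (neg_le_neg ?_)
    rw [le_div_iff₀ (by positivity)]
    calc (n : ℝ) ^ (1 / 5 : ℝ) / 200 * (8 * (R : ℝ) ^ 2)
        ≤ (n : ℝ) ^ (1 / 5 : ℝ) / 200 * (8 * (5 * (n : ℝ) ^ (3 / 5 : ℝ)) ^ 2) := by gcongr
      _ = (n : ℝ) ^ (1 / 5 : ℝ) * ((n : ℝ) ^ (3 / 5 : ℝ) * (n : ℝ) ^ (3 / 5 : ℝ)) := by ring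
      _ = (n : ℝ) ^ (7 / 5 : ℝ) := by
        rw [← Real.rpow_add hn0, ← Real.rpow_add hn0]; norm_num
      _ ≤ ℓ := hℓ1
  have h2 : (n : ℝ) * m * (ℓ * (ℓ * Real.exp (-((n : ℝ) ^ (3 / 5 : ℝ) / 16)))) ≤
      8 * (n : ℝ) ^ 6 * E := by
    calc _ ≤ (n : ℝ) * (2 * n) * (2 * (n : ℝ) ^ 2 * (2 * (n : ℝ) ^ 2 * E)) := by gcongr
      _ = _ := by ring
  have h3 : (n : ℝ) * m * (n * m * (n * m * (2 * Real.exp (-(ℓ / (8 * (R : ℝ) ^ 2)))))) ≤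
      16 * (n : ℝ) ^ 6 * E := by
    calc _ ≤ (n : ℝ) * (2 * n) * (n * (2 * n) * (n * (2 * n) * (2 * E))) := by gcongr
      _ = _ := by ring
  linarith

end Asymptotics

end CRSF

/-! ### The regime `m = n + C √(n log n) (1 + o(1))` -/

theorem mainTheorem4 (C : ℝ) (hC : Real.sqrt 2 < |C|) (m : ℕ → ℕ) (δ : ℕ → ℝ)
    (hδ : Tendsto δ atTop (𝓝 0))
    (hm : ∀ᶠ n : ℕ in atTop,
      (m n : ℝ) = (n : ℝ) + C * Real.sqrt ((n : ℝ) * Real.log (n : ℝ)) * (1 + δ n))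
    (ε : ℝ) (hε : 0 < ε) :
    ∀ᶠ n : ℕ in atTop,
      (CRSF.crsfMeasure n (m n)).real (CRSF.twoDisjointCycles n (m n)) ≤
        (n : ℝ) ^ ((1 : ℝ) / 2 - C ^ 2 / 4 + ε) := by
  have hC0 : 0 < C ^ 2 := by
    have : 0 < |C| := (Real.sqrt_nonneg 2).trans_lt hC
    exact sq_pos_of_ne_zero (abs_pos.mp this)
  have hcast : Tendsto (fun n : ℕ => (n : ℝ)) atTop atTop := tendsto_natCast_atTop_atTop
  have hpow : ∀ s : ℝ, 0 < s → Tendsto (fun n : ℕ => (n : ℝ) ^ s) atTop atTop := fun s hs =>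
    (tendsto_rpow_atTop hs).comp hcast
  have hclose : ∀ᶠ n : ℕ in atTop, |(m n : ℝ) - n| ≤ (n : ℝ) ^ (3 / 5 : ℝ) / 4 := by
    have hlog : ∀ᶠ n : ℕ in atTop, Real.log n ≤ 1 / (64 * C ^ 2) * (n : ℝ) ^ (1 / 5 : ℝ) := by
      have := (isLittleO_log_rpow_atTop (show (0 : ℝ) < 1 / 5 by norm_num)).bound
        (show 0 < 1 / (64 * C ^ 2) by positivity)
      filter_upwards [hcast.eventually this, eventually_ge_atTop 1] with n h hn
      rw [Real.norm_of_nonneg (Real.log_natCast_nonneg n),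
        Real.norm_of_nonneg (by positivity)] at h
      exact h
    have hδ1 : ∀ᶠ n in atTop, |1 + δ n| ≤ 2 := by
      have h : Tendsto (fun n => |1 + δ n|) atTop (𝓝 |1 + 0|) := (hδ.const_add 1).abs
      rw [add_zero, abs_one] at h
      exact h.eventually_le_const (by norm_num)
    filter_upwards [hm, hlog, hδ1, eventually_ge_atTop 1] with n hm hlog hδ1 hn
    have hn0 : (0 : ℝ) < n := by exact_mod_cast hn
    have hl0 := Real.log_natCast_nonneg n
    refine abs_le_of_sq_le_sq ?_ (by positivity)
    have hd2 : (1 + δ n) ^ 2 ≤ 4 := by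
      rw [← sq_abs]; nlinarith [abs_nonneg (1 + δ n)]
    have e : (m n : ℝ) - n = C * Real.sqrt (n * Real.log n) * (1 + δ n) := by rw [hm]; ring
    rw [e, mul_pow, mul_pow, Real.sq_sqrt (by positivity)]
    calc C ^ 2 * (n * Real.log n) * (1 + δ n) ^ 2
        ≤ C ^ 2 * (n * (1 / (64 * C ^ 2) * (n : ℝ) ^ (1 / 5 : ℝ))) * 4 := by gcongr
      _ = (n : ℝ) * (n : ℝ) ^ (1 / 5 : ℝ) / 16 := by
        have hC1 : C ≠ 0 := by rintro rfl; simp at hC0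
        field_simp
        norm_num
      _ = ((n : ℝ) ^ (3 / 5 : ℝ) / 4) ^ 2 := by
        rw [div_pow, ← Real.rpow_natCast, ← Real.rpow_mul hn0.le,
          ← Real.rpow_one_add' hn0.le (by norm_num)]
        norm_num
  -- `(m - n)²` is `C² n log n (1 + δ n)²` and `max n m` is at most `n (1 + n ^ (-2/5))`, so the
  -- exponent is asymptotically at least `(C² / 4) log n`.
  have hr : ∀ κ < C ^ 2 / 4, ∀ᶠ n : ℕ in atTop,
      Real.exp (-(((m n : ℝ) - n) ^ 2 / (4 * (max n (m n) : ℕ)))) ≤ (n : ℝ) ^ (-κ) := by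
    intro κ hκ
    have hlim : Tendsto (fun n : ℕ => C ^ 2 / 4 * (1 + δ n) ^ 2 / (1 + (n : ℝ) ^ (-(2 / 5) : ℝ)))
        atTop (𝓝 (C ^ 2 / 4 * (1 + 0) ^ 2 / (1 + 0))) := by
      have h1 := ((hδ.const_add 1).pow 2).const_mul (C ^ 2 / 4)
      have h2 := ((tendsto_rpow_neg_atTop (show (0 : ℝ) < 2 / 5 by norm_num)).comp hcast).const_add 1
      exact h1.div h2 (by norm_num)
    norm_num at hlim
    filter_upwards [hm, hclose, hlim.eventually_const_le hκ, eventually_ge_atTop 1] with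
      n hm hclose hlim hn
    have hn0 : (0 : ℝ) < n := by exact_mod_cast hn
    have hl0 := Real.log_natCast_nonneg n
    rw [Real.rpow_def_of_pos hn0]
    refine Real.exp_le_exp.mpr ?_
    rw [mul_neg, neg_le_neg_iff]
    have hmax0 : (0 : ℝ) < (max n (m n) : ℕ) := by exact_mod_cast (by omega : 0 < max n (m n))
    have hmax : ((max n (m n) : ℕ) : ℝ) ≤ n * (1 + (n : ℝ) ^ (-(2 / 5) : ℝ)) := by
      have e35 : (n : ℝ) * (n : ℝ) ^ (-(2 / 5) : ℝ) = (n : ℝ) ^ (3 / 5 : ℝ) := by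
        rw [← Real.rpow_one_add' hn0.le (by norm_num)]; norm_num
      have h0 : 0 < (n : ℝ) ^ (3 / 5 : ℝ) := by positivity
      rw [mul_add, mul_one, e35, Nat.cast_max]
      exact max_le (by linarith) (by linarith [(abs_le.mp hclose).2])
    have e : (m n : ℝ) - n = C * Real.sqrt (n * Real.log n) * (1 + δ n) := by rw [hm]; ring
    rw [le_div_iff₀ (by positivity), e, mul_pow, mul_pow, Real.sq_sqrt (by positivity)]
    have hp : 0 < 1 + (n : ℝ) ^ (-(2 / 5) : ℝ) := by positivity
    rw [le_div_iff₀ hp] at hlim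
    rcases le_or_gt κ 0 with hκ0 | hκ0
    · have h1 : Real.log n * κ * (4 * ((max n (m n) : ℕ) : ℝ)) ≤ 0 :=
        mul_nonpos_of_nonpos_of_nonneg (mul_nonpos_of_nonneg_of_nonpos hl0 hκ0) (by positivity)
      exact h1.trans (by positivity)
    · calc Real.log n * κ * (4 * ((max n (m n) : ℕ) : ℝ))
          ≤ Real.log n * κ * (4 * (n * (1 + (n : ℝ) ^ (-(2 / 5) : ℝ)))) := by gcongr
        _ = 4 * n * Real.log n * (κ * (1 + (n : ℝ) ^ (-(2 / 5) : ℝ))) := by ring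
        _ ≤ 4 * n * Real.log n * (C ^ 2 / 4 * (1 + δ n) ^ 2) := by gcongr
        _ = _ := by ring
  have hhalf : ∀ᶠ n : ℕ in atTop,
      Real.exp (-(((m n : ℝ) - n) ^ 2 / (4 * (max n (m n) : ℕ)))) ≤ 1 / 2 := by
    have h := (tendsto_rpow_neg_atTop (show (0 : ℝ) < C ^ 2 / 8 by positivity)).comp hcast
    filter_upwards [hr (C ^ 2 / 8) (by linarith),
      h.eventually_le_const (show (0 : ℝ) < 1 / 2 by norm_num)] with n h1 h2
    exact h1.trans h2
  have herr : ∀ᶠ n : ℕ in atTop, 24 * (n : ℝ) ^ 6 * Real.exp (-((n : ℝ) ^ (1 / 5 : ℝ) / 200)) ≤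
      1 / 2 * (n : ℝ) ^ ((1 : ℝ) / 2 - C ^ 2 / 4 + ε) := by
    set β := (1 : ℝ) / 2 - C ^ 2 / 4 + ε
    -- Applied at `x = n ^ (1/5)`, where `x ^ (5 (6 - β))` is `n ^ (6 - β)`.
    have h := (isLittleO_rpow_exp_pos_mul_atTop (5 * (6 - β))
      (show (0 : ℝ) < 1 / 200 by norm_num)).bound (show (0 : ℝ) < 1 / 48 by norm_num)
    filter_upwards [(hpow (1 / 5) (by norm_num)).eventually h, eventually_ge_atTop 1] with n h hn
    have hn0 : (0 : ℝ) < n := by exact_mod_cast hn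
    rw [Real.norm_of_nonneg (by positivity), Real.norm_of_nonneg (by positivity),
      ← Real.rpow_mul hn0.le, show (1 : ℝ) / 5 * (5 * (6 - β)) = 6 - β by ring,
      Real.rpow_sub hn0, div_le_iff₀ (by positivity)] at h
    rw [Real.exp_neg, ← div_eq_mul_inv, div_le_iff₀ (Real.exp_pos _)]
    have e6 : (n : ℝ) ^ (6 : ℝ) = (n : ℝ) ^ 6 := by
      rw [← Real.rpow_natCast]; norm_num
    rw [e6, show (1 : ℝ) / 200 * (n : ℝ) ^ (1 / 5 : ℝ) = (n : ℝ) ^ (1 / 5 : ℝ) / 200 by ring] at h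
    linarith
  -- Half of `ε` pays for the loss in the Gaussian exponent; the other half absorbs the constant
  -- through `n ^ (ε / 2) ≥ 8`.
  filter_upwards [hclose, hr (C ^ 2 / 4 - ε / 2) (by linarith), hhalf, herr,
    (hpow (ε / 2) (by positivity)).eventually_ge_atTop 8, eventually_ge_atTop 1] with
    n hclose hr hhalf herr h8 hn
  have hn0 : (0 : ℝ) < n := by exact_mod_cast hn
  refine (CRSF.crsfMeasure_real_twoDisjointCycles_le_of_close hn hclose le_rfl hhalf).trans ?_
  have hmain : 4 * Real.sqrt n * Real.exp (-(((m n : ℝ) - n) ^ 2 / (4 * (max n (m n) : ℕ)))) ≤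
      1 / 2 * (n : ℝ) ^ ((1 : ℝ) / 2 - C ^ 2 / 4 + ε) := by
    calc _ ≤ 4 * Real.sqrt n * (n : ℝ) ^ (-(C ^ 2 / 4 - ε / 2)) := by gcongr
      _ = 1 / 2 * (Real.sqrt n * (n : ℝ) ^ (-(C ^ 2 / 4 - ε / 2)) * 8) := by ring
      _ ≤ 1 / 2 * (Real.sqrt n * (n : ℝ) ^ (-(C ^ 2 / 4 - ε / 2)) * (n : ℝ) ^ (ε / 2)) := by gcongr
      _ = _ := by
        rw [Real.sqrt_eq_rpow, ← Real.rpow_add hn0, ← Real.rpow_add hn0]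
        congr 2
        ring
  linarith
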